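/- Let $\mathbf F_q$ be a finite field with $q\ge 4$ elements, and let $P$ be a closed point of degree $3$ of the projective plane $\mathbf P^2$ over $\mathbf F_q$ which is not contained in any $\mathbf F_q$-rational line. Let $\pi : Z\to\mathbf P^2$ be the blow-up of $\mathbf P^2$ at $P$, with exceptional divisor $E$. Let $\Gamma_4$ be the linear system of plane curves of degree $4$ containing $P$, and let $\mathcal L_4$ be the line bundle on $Z$ associated to $\pi^*\Gamma_4-E$, that is, $\mathcal L_4=\pi^*\mathcal O_{\mathbf P^2}(4)\otimes\mathcal O_Z(-E)$. Let $P_1,\dots,P_n$ be all the $\mathbf F_q$-rational points of $Z$, and let $C_L(Z,\mathcal L_4)\subseteq\mathbf F_q^n$ be the image of the evaluation map $$H^0(Z,\mathcal L_4)\to\bigoplus_{i=1}^n(\mathcal L_4)_{P_i}\simeq\mathbf F_q^n,\qquad f\mapsto(f_{P_1},\dots,f_{P_n}),$$ for a choice of coordinates on the fibres, given by choosing an $\mathbf F_q$-rational vector representing each point $\pi(P_i)$. Then $C_L(Z,\mathcal L_4)$ is a $[q^2+q+1,\,12,\,q^2-2q-1]$ code: its length is $n=q^2+q+1$, its dimension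 is $12$ and its minimum distance is exactly $q^2-2q-1$. Moreover, for $q=7$ such a point $P$ exists and $C_L(Z,\mathcal L_4)$ is a $[57,12,34]$ code over $\mathbf F_7$. -/

import Mathlib

open scoped LinearAlgebra.Projectivization

namespace BlowUpCode

/-! ### Parameters of a linear code -/

/-- `C ⊆ F ^ ι` is an `[n, k, d]` code: it has length `n`, dimension `k`, and its minimum distance,
the least number of positions in which two distinct codewords differ, is (exactly) `d`. -/
structure HasParameters {F ι : Type*} [Field F] (C : Submodule F (ι → F)) (n k d : ℕ) : Prop where
  length : Nat.card ι = n
  dim : Module.finrank F C = k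
  minDist : IsLeast {m | ∃ c ∈ C, ∃ c' ∈ C, c ≠ c' ∧ {i | c i ≠ c' i}.ncard = m} d

/-! ### The projective plane and its Frobenius map

`F` is the finite base field and `K` is an algebraic closure of `F`. Varieties over `F` are
represented by their sets of `K`-points with the action of the Frobenius map of `F`. -/

section Plane

variable (F K : Type*) [Field F] [Fintype F] [Field K] [Algebra F K]

/-- The coordinatewise Frobenius map `x ↦ x ^ #F` on `K ^ 3`. -/
noncomputable def frobVec :
    (Fin 3 → K) →ₛₗ[(FiniteField.frobeniusAlgHom F K : K →ₐ[F] K).toRingHom] (Fin 3 → K) where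
  toFun v j := FiniteField.frobeniusAlgHom F K (v j)
  map_add' v w := by ext j; simp [map_add]
  map_smul' c v := by ext j; simp [map_mul]

lemma frobVec_apply (v : Fin 3 → K) (j : Fin 3) :
    frobVec F K v j = FiniteField.frobeniusAlgHom F K (v j) := rfl

lemma frobVec_injective : Function.Injective (frobVec F K) := by
  intro v w h
  ext j
  exact (FiniteField.frobeniusAlgHom F K).toRingHom.injective (congrFun h j)

lemma frobVec_ne_zero {v : Fin 3 → K} (hv : v ≠ 0) : frobVec F K v ≠ 0 := fun h =>
  hv (frobVec_injective F K (h.trans (map_zero _).symm))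

/-- The Frobenius map on the projective plane. A line is represented by the vector of coefficients
of an equation, so this is also the action of the Frobenius map on the set of lines. The rational
points and the rational lines are those which this map fixes. -/
noncomputable def frob : ℙ K (Fin 3 → K) → ℙ K (Fin 3 → K) :=
  Projectivization.map (frobVec F K) (frobVec_injective F K)

lemma frob_injective : Function.Injective (frob F K) := by
  intro x y h
  induction x with | h v hv =>
  induction y with | h w hw =>
  rw [frob, Projectivization.map_mk, Projectivization.map_mk,
    Projectivization.mk_eq_mk_iff_crossProduct_eq_zero] at h
  rw [Projectivization.mk_eq_mk_iff_crossProduct_eq_zero]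
  apply frobVec_injective F K
  rw [map_zero, ← h]
  simp only [cross_apply]
  ext j
  fin_cases j <;> simp only [frobVec_apply] <;> exact (map_sub _ _ _).trans (by simp [mul_pow])

variable {K} in
lemma dotProduct_frobVec (v w : Fin 3 → K) :
    frobVec F K v ⬝ᵥ frobVec F K w = FiniteField.frobeniusAlgHom F K (v ⬝ᵥ w) := by
  change ∑ j, FiniteField.frobeniusAlgHom F K (v j) * FiniteField.frobeniusAlgHom F K (w j) = _
  simp only [dotProduct, map_sum, map_mul]

variable {K} in
lemma orthogonal_frob {x l : ℙ K (Fin 3 → K)} (h : x.orthogonal l) :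
    (frob F K x).orthogonal (frob F K l) := by
  induction x with | h v hv =>
  induction l with | h w hw =>
  rw [Projectivization.orthogonal_mk] at h
  rw [frob, Projectivization.map_mk, Projectivization.map_mk, Projectivization.orthogonal_mk,
    dotProduct_frobVec, h, map_zero]

/-- A closed point of degree `3` of the projective plane over `F` which is not contained in any
rational line, given by one of the three conjugate geometric points into which it splits. -/
structure CubicPoint where
  /-- one of the geometric points -/
  pt : ℙ K (Fin 3 → K)
  /-- it has exactly three conjugates -/
  degree_eq : Function.minimalPeriod (frob F K) pt = 3
  /-- it lies on no rational line -/
  notMem_line : ∀ l : ℙ K (Fin 3 → K), frob F K l = l → ¬ pt.orthogonal l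

end Plane

/-! ### The blow-up `Z` of the plane at a closed point of degree three -/

variable {F K : Type*} [Field F] [Fintype F] [Field K] [Algebra F K]

namespace CubicPoint

variable (P : CubicPoint F K)

/-- The three conjugate geometric points `p, φ p, φ² p`. -/
noncomputable def conj (i : Fin 3) : ℙ K (Fin 3 → K) := (frob F K)^[i] P.pt

lemma frob_conj (i : Fin 3) : frob F K (P.conj i) = P.conj (i + 1) := by
  have h : (frob F K)^[3] P.pt = P.pt := by
    have := Function.iterate_minimalPeriod (f := frob F K) (x := P.pt)
    rwa [P.degree_eq] at this
  fin_cases i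
  · rfl
  · rfl
  · exact h

/-- Multihomogeneous coordinates of a point of the blow-up `Z` of the plane at the three conjugate
points: a vector representing a point `x` of the plane and, for each `i`, a vector of coefficients
of a line through `x` and the `i`-th conjugate point. -/
@[ext] structure Coords where
  /-- coordinates of the point `x` of the plane -/
  vec : Fin 3 → K
  /-- coefficients of the three lines -/
  line : Fin 3 → Fin 3 → K
  vec_ne : vec ≠ 0
  line_ne : ∀ i, line i ≠ 0
  mem_line : ∀ i, (Projectivization.mk K vec vec_ne).orthogonal (Projectivization.mk K _ (line_ne i))
  conj_mem_line : ∀ i, (P.conj i).orthogonal (Projectivization.mk K _ (line_ne i))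

/-- The surface `Z`, the projective plane blown up at the given closed point: the closed subvariety
of `ℙ² × (ℙ²)^∨ × (ℙ²)^∨ × (ℙ²)^∨` of all `(x, l₀, l₁, l₂)` where the line `l i` contains `x` and
the `i`-th conjugate point. (Blowing up one point `p` gives the variety of pairs `(x, l)` where `l`
is a line through `x` and `p`; the three centres are disjoint, so the blow-up of all three is the
fibre product of these over the plane.) -/
structure Z where
  /-- the image of the point under the blow-up map `π : Z → ℙ²` -/
  π : ℙ K (Fin 3 → K)
  /-- the three lines -/
  line : Fin 3 → ℙ K (Fin 3 → K)
  mem_line : ∀ i, π.orthogonal (line i)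
  conj_mem_line : ∀ i, (P.conj i).orthogonal (line i)

variable {P}

/-- The point of `Z` with given multihomogeneous coordinates. -/
def Coords.toZ (w : P.Coords) : P.Z where
  π := Projectivization.mk K w.vec w.vec_ne
  line i := Projectivization.mk K (w.line i) (w.line_ne i)
  mem_line := w.mem_line
  conj_mem_line := w.conj_mem_line

/-- The Frobenius map on multihomogeneous coordinates. As it maps the `i`-th conjugate point to the
`(i + 1)`-st one, it also permutes the three lines cyclically. -/
noncomputable def Coords.frob (w : P.Coords) : P.Coords where
  vec := frobVec F K w.vec
  line i := frobVec F K (w.line (i - 1))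
  vec_ne := frobVec_ne_zero F K w.vec_ne
  line_ne i := frobVec_ne_zero F K (w.line_ne (i - 1))
  mem_line i := orthogonal_frob F (w.mem_line (i - 1))
  conj_mem_line i := by
    have := orthogonal_frob F (w.conj_mem_line (i - 1))
    rwa [frob_conj, sub_add_cancel] at this

/-- The Frobenius map on `Z`. -/
noncomputable def Z.frob (z : P.Z) : P.Z where
  π := BlowUpCode.frob F K z.π
  line i := BlowUpCode.frob F K (z.line (i - 1))
  mem_line i := orthogonal_frob F (z.mem_line (i - 1))
  conj_mem_line i := by
    have := orthogonal_frob F (z.conj_mem_line (i - 1))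
    rwa [frob_conj, sub_add_cancel] at this

lemma Coords.toZ_frob (w : P.Coords) : w.frob.toZ = w.toZ.frob := rfl

/-- The exceptional divisor `E` of the blow-up (over `K` it has three components). -/
def Z.exceptional (P : CubicPoint F K) : Set P.Z := {z | ∃ i, z.π = P.conj i}

variable (P) in
/-- The rational points of `Z`. -/
def RatPoint : Type _ := {z : P.Z // z.frob = z}

/-- No rational point lies on the exceptional divisor. -/
lemma RatPoint.notMem_exceptional (z : P.RatPoint) : z.1 ∉ Z.exceptional P := by
  rintro ⟨i, hi⟩
  have h1 : BlowUpCode.frob F K z.1.π = z.1.π := congrArg Z.π z.2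
  have h2 : Function.IsPeriodicPt (BlowUpCode.frob F K) 1 z.1.π := h1
  have h3 : BlowUpCode.frob F K P.pt = P.pt := by
    have hper : (BlowUpCode.frob F K)^[3] P.pt = P.pt := by
      have := Function.iterate_minimalPeriod (f := BlowUpCode.frob F K) (x := P.pt)
      rwa [P.degree_eq] at this
    have hinj : Function.Injective (BlowUpCode.frob F K) :=
      frob_injective F K
    rw [hi] at h1
    exact hinj.iterate (i : ℕ) (by
      rw [← Function.iterate_succ_apply, Function.iterate_succ_apply']; exact h1)
  have h4 : Function.minimalPeriod (BlowUpCode.frob F K) P.pt ≤ 1 :=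
    Function.IsPeriodicPt.minimalPeriod_le one_pos h3
  rw [P.degree_eq] at h4
  omega

/-! ### The line bundles `L_d` and their global sections -/

/-- The multidegrees of the multihomogeneous coordinates. -/
def multidegree : Fin 3 ⊕ Fin 3 × Fin 3 → ℕ × (Fin 3 → ℕ) :=
  Sum.elim (fun _ => (1, 0)) (fun ij => (0, Pi.single ij.1 1))

/-- The value of a polynomial in the multihomogeneous coordinates. -/
noncomputable def Coords.eval (w : P.Coords) (A : MvPolynomial (Fin 3 ⊕ Fin 3 × Fin 3) K) : K :=
  MvPolynomial.eval (Sum.elim w.vec (fun ij => w.line ij.1 ij.2)) A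

/-- `s` is a regular section over `Z` of the pullback `π^* O(d)`: a function of the multihomogeneous
coordinates which locally is a quotient `A / B` of multihomogeneous polynomials, where the
multidegree of `A` exceeds that of `B` by `d` in the coordinates of the plane and by `0` in the
coordinates of each of the three lines. -/
def IsRegularSection (d : ℕ) (s : P.Coords → K) : Prop :=
  ∀ w₀ : P.Coords, ∃ (A B : MvPolynomial (Fin 3 ⊕ Fin 3 × Fin 3) K) (a : ℕ) (b : Fin 3 → ℕ),
    A.IsWeightedHomogeneous multidegree (a + d, b) ∧ B.IsWeightedHomogeneous multidegree (a, b) ∧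
      w₀.eval B ≠ 0 ∧ ∀ w : P.Coords, w.eval B ≠ 0 → s w = w.eval A / w.eval B

variable (P) in
/-- The space `H⁰(Z, L_d)`. The line bundle `L_d`, associated to the linear system `π^* Γ_d - E`
(where `Γ_d` consists of the plane curves of degree `d` through the blown-up point), is
`π^* O(d) ⊗ O(-E)`, that is, the subsheaf of `π^* O(d)` of sections vanishing on `E`. Its global
sections over `F` are those over `K` that commute with the Frobenius map. -/
noncomputable def globalSections (d : ℕ) : Submodule F (P.Coords → K) where
  carrier := {s | IsRegularSection d s ∧ (∀ w, w.toZ ∈ Z.exceptional P → s w = 0) ∧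
    ∀ w, s w.frob = s w ^ Fintype.card F}
  zero_mem' := by
    refine ⟨fun w₀ => ⟨0, 1, 0, 0, MvPolynomial.isWeightedHomogeneous_zero _ _ _,
      MvPolynomial.isWeightedHomogeneous_one _ _, by simp [Coords.eval], by simp [Coords.eval]⟩,
      fun _ _ => rfl, fun w => by simp [Fintype.card_ne_zero]⟩
  add_mem' := by
    rintro s t ⟨hs, hs', hs''⟩ ⟨ht, ht', ht''⟩
    refine ⟨fun w₀ => ?_, fun w hw => by simp [hs' w hw, ht' w hw], fun w => ?_⟩
    · obtain ⟨A, B, a, b, hA, hB, hB0, h⟩ := hs w₀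
      obtain ⟨A', B', a', b', hA', hB', hB0', h'⟩ := ht w₀
      refine ⟨A * B' + B * A', B * B', a + a', b + b', ?_, hB.mul hB', ?_, fun w hw => ?_⟩
      · refine MvPolynomial.IsWeightedHomogeneous.add ?_ ?_
        · convert hA.mul hB' using 1
          ext <;> simp; ring
        · convert hB.mul hA' using 1
          ext <;> simp; ring
      · simp only [Coords.eval, map_mul] at *
        exact mul_ne_zero hB0 hB0'
      · have hw' : w.eval B * w.eval B' ≠ 0 := by simpa [Coords.eval] using hw
        have h1 := left_ne_zero_of_mul hw'
        have h2 := right_ne_zero_of_mul hw'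
        rw [Pi.add_apply, h w h1, h' w h2, div_add_div _ _ h1 h2]
        simp [Coords.eval]
    · have := map_add (FiniteField.frobeniusAlgHom F K) (s w) (t w)
      simp only [FiniteField.coe_frobeniusAlgHom] at this
      rw [Pi.add_apply, Pi.add_apply, hs'', ht'', this]
  smul_mem' := by
    rintro c s ⟨hs, hs', hs''⟩
    refine ⟨fun w₀ => ?_, fun w hw => by simp [hs' w hw], fun w => ?_⟩
    · obtain ⟨A, B, a, b, hA, hB, hB0, h⟩ := hs w₀
      refine ⟨MvPolynomial.C (algebraMap F K c) * A, B, a, b, ?_, hB, hB0, fun w hw => ?_⟩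
      · simpa using (MvPolynomial.isWeightedHomogeneous_C _ (algebraMap F K c)).mul hA
      · rw [Pi.smul_apply, h w hw, Algebra.smul_def, ← mul_div_assoc]
        simp [Coords.eval]
    · rw [Pi.smul_apply, Pi.smul_apply, hs'', Algebra.smul_def, Algebra.smul_def, mul_pow,
        ← map_pow, FiniteField.pow_card]

/-! ### The code `C_L(Z, L_d)` -/

variable (P) in
/-- A choice of coordinates on the fibres of the line bundles at the rational points. A rational
point `z` is not on the exceptional divisor, so the fibre of `L_d` at `z` is that of `π^* O(d)`; a
rational vector representing `π z` identifies it with `F`, by evaluation of sections at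
multihomogeneous coordinates of `z` which extend that vector (the value does not depend on the
vectors chosen for the lines). -/
structure FibreCoords where
  /-- multihomogeneous coordinates of the rational points -/
  coords : P.RatPoint → P.Coords
  toZ_coords : ∀ z, (coords z).toZ = z.1
  rational : ∀ z, frobVec F K (coords z).vec = (coords z).vec

lemma eval_eq_of_smul_line {A : MvPolynomial (Fin 3 ⊕ Fin 3 × Fin 3) K} {a : ℕ} {b : Fin 3 → ℕ}
    (hA : A.IsWeightedHomogeneous multidegree (a, b)) {w w' : P.Coords} (hv : w.vec = w'.vec)
    {c : Fin 3 → Kˣ} (hc : ∀ i, c i • w'.line i = w.line i) :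
    w.eval A = (∏ i, (c i : K) ^ b i) * w'.eval A := by
  rw [Coords.eval, Coords.eval, MvPolynomial.eval_eq', MvPolynomial.eval_eq', Finset.mul_sum]
  refine Finset.sum_congr rfl fun D hD => ?_
  have hb : ∀ i, ∑ j, D (Sum.inr (i, j)) = b i := fun i => by
    have h := congrFun (congrArg Prod.snd (hA (MvPolynomial.mem_support_iff.1 hD))) i
    rw [Finsupp.weight_apply, Finsupp.sum_fintype _ _ (by simp)] at h
    simpa [multidegree, Fintype.sum_prod_type, Prod.snd_sum, Finset.sum_apply, Pi.single_apply]
      using h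
  have hl : ∀ i j, w.line i j = (c i : K) * w'.line i j := fun i j => by rw [← hc i]; rfl
  simp only [Fintype.prod_sum_type, Fintype.prod_prod_type, Sum.elim_inl, Sum.elim_inr, hv, hl,
    mul_pow, Finset.prod_mul_distrib, Finset.prod_pow_eq_pow_sum, hb]
  ring

/-- Any two systems of multihomogeneous coordinates of the same point of `Z` which agree in the
coordinates of the plane give the same value of a section. -/
lemma IsRegularSection.congr {d : ℕ} {s : P.Coords → K} (hs : IsRegularSection d s)
    {w w' : P.Coords} (hz : w.toZ = w'.toZ) (hv : w.vec = w'.vec) : s w = s w' := by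
  have hline : ∀ i, ∃ c : Kˣ, c • w'.line i = w.line i := fun i =>
    (Projectivization.mk_eq_mk_iff K _ _ (w.line_ne i) (w'.line_ne i)).1
      (congrFun (congrArg Z.line hz) i)
  choose c hc using hline
  obtain ⟨A, B, a, b, hA, hB, hB0, h⟩ := hs w'
  have h1 : w.eval A = (∏ i, (c i : K) ^ b i) * w'.eval A := eval_eq_of_smul_line hA hv hc
  have h2 : w.eval B = (∏ i, (c i : K) ^ b i) * w'.eval B := eval_eq_of_smul_line hB hv hc
  have h3 : (∏ i, (c i : K) ^ b i) ≠ 0 :=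
    Finset.prod_ne_zero_iff.2 fun i _ => pow_ne_zero _ (c i).ne_zero
  rw [h w' hB0, h w (by rw [h2]; exact mul_ne_zero h3 hB0), h1, h2, mul_div_mul_left _ _ h3]

/-- The value of a section over `F` at a rational point lies in `F`. -/
lemma FibreCoords.apply_mem_range (e : FibreCoords P) {d : ℕ} {s : P.Coords → K}
    (hs : s ∈ globalSections P d) (z : P.RatPoint) :
    s (e.coords z) ∈ Set.range (algebraMap F K) := by
  have h : s (e.coords z).frob = s (e.coords z) := by
    refine hs.1.congr ?_ (e.rational z)
    rw [Coords.toZ_frob, e.toZ_coords, z.2]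
  rw [hs.2.2] at h
  have hprod : ∏ c : F, (s (e.coords z) - algebraMap F K c) = 0 := by
    have hroots := FiniteField.roots_X_pow_card_sub_X F
    have hdeg := FiniteField.X_pow_card_sub_X_natDegree_eq F (Fintype.one_lt_card (α := F))
    have hmonic : (Polynomial.X ^ Fintype.card F - Polynomial.X : Polynomial F).Monic :=
      Polynomial.monic_X_pow_sub (by
        rw [Polynomial.degree_X]; exact_mod_cast Fintype.one_lt_card (α := F))
    have := congrArg (Polynomial.aeval (s (e.coords z)))
      (Polynomial.prod_multiset_X_sub_C_of_monic_of_roots_card_eq hmonic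
        (by rw [hroots, hdeg]; rfl))
    rw [hroots] at this
    simpa [map_multiset_prod, h] using this
  obtain ⟨c, -, hc⟩ := Finset.prod_eq_zero_iff.1 hprod
  exact ⟨c, (sub_eq_zero.1 hc).symm⟩

/-- The evaluation map `H⁰(Z, L_d) → F ^ n`. -/
noncomputable def FibreCoords.ev (e : FibreCoords P) (d : ℕ) :
    globalSections P d →ₗ[F] (P.RatPoint → F) where
  toFun s z := (e.apply_mem_range s.2 z).choose
  map_add' s t := by
    ext z
    apply (algebraMap F K).injective
    rw [Pi.add_apply, map_add, (e.apply_mem_range s.2 z).choose_spec,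
      (e.apply_mem_range t.2 z).choose_spec, (e.apply_mem_range (s + t).2 z).choose_spec]
    rfl
  map_smul' c s := by
    ext z
    apply (algebraMap F K).injective
    rw [Pi.smul_apply, smul_eq_mul, map_mul, (e.apply_mem_range s.2 z).choose_spec,
      (e.apply_mem_range (c • s).2 z).choose_spec]
    exact Algebra.smul_def _ _

lemma FibreCoords.algebraMap_ev (e : FibreCoords P) {d : ℕ} (s : globalSections P d)
    (z : P.RatPoint) : algebraMap F K (e.ev d s z) = s.1 (e.coords z) :=
  (e.apply_mem_range s.2 z).choose_spec

/-- The code `C_L(Z, L_d)`, the image of the evaluation map at the rational points of `Z`. -/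
noncomputable def FibreCoords.code (e : FibreCoords P) (d : ℕ) : Submodule F (P.RatPoint → F) :=
  LinearMap.range (e.ev d)

/-- Coordinates on the fibres at the rational points exist. -/
instance : Nonempty (FibreCoords P) := by
  have key : ∀ z : P.RatPoint, ∃ w : P.Coords, w.toZ = z.1 ∧ frobVec F K w.vec = w.vec := by
    rintro ⟨z, hz⟩
    have hfix : BlowUpCode.frob F K z.π = z.π := congrArg Z.π hz
    have hv : ∃ (v : Fin 3 → K) (hv : v ≠ 0), Projectivization.mk K v hv = z.π ∧
        frobVec F K v = v := by
      generalize z.π = x at hfix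
      induction x with | h v hv =>
      obtain ⟨j, hj⟩ := Function.ne_iff.1 hv
      have hj' : v j ≠ 0 := hj
      rw [BlowUpCode.frob, Projectivization.map_mk, Projectivization.mk_eq_mk_iff'] at hfix
      obtain ⟨c, hc⟩ := hfix
      have hne : (v j)⁻¹ • v ≠ 0 := smul_ne_zero (inv_ne_zero hj') hv
      refine ⟨(v j)⁻¹ • v, hne, ?_, ?_⟩
      · rw [Projectivization.mk_eq_mk_iff']
        exact ⟨_, rfl⟩
      · have hcj : c * v j = FiniteField.frobeniusAlgHom F K (v j) := congrFun hc j
        have hc0 : c ≠ 0 := by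
          rintro rfl
          rw [zero_mul] at hcj
          exact hj' ((map_eq_zero _).1 hcj.symm)
        rw [LinearMap.map_smulₛₗ, ← hc, smul_smul]
        congr 1
        change FiniteField.frobeniusAlgHom F K (v j)⁻¹ * c = _
        rw [map_inv₀, ← hcj]
        field_simp
    obtain ⟨v, hv, hvx, hvf⟩ := hv
    refine ⟨⟨v, fun i => (z.line i).rep, hv, fun i => (z.line i).rep_nonzero, fun i => ?_,
      fun i => ?_⟩, ?_, hvf⟩
    · rw [Projectivization.mk_rep, hvx]; exact z.mem_line i
    · rw [Projectivization.mk_rep]; exact z.conj_mem_line i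
    · cases z
      simp only [Coords.toZ, Projectivization.mk_rep] at *
      simp [hvx]
  choose f hf hf' using key
  exact ⟨⟨f, hf, hf'⟩⟩

end CubicPoint
end BlowUpCode

namespace BlowUpCode

open MvPolynomial

/-! Away from the three centres the lines of a point of `Z` are determined by its image in the
plane, so a section there is a function on affine 3-space minus three lines through the origin that
is locally a quotient of polynomials. The removed set has codimension two, so the function is a
polynomial, a form of degree `d`. Vanishing on `E` makes the form vanish at the centres, and
compatibility with Frobenius puts its coefficients in `F`. No centre is rational, so the rational
points of `Z` are the q² + q + 1 rational points of the plane. The code is therefore obtained by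
evaluating quartics through the cubic point at all rational points of the plane (`code_eq_range`).

Evaluation at the cubic point maps quartics onto a field of q³ elements, so the quartics through it
have dimension 15 - 3 = 12. It remains to see that the maximal number of rational zeros of a nonzero
quartic through it is 3q + 2.

Upper bound (`card_zeros_quartic_le`): a rational line can be split off with the cofactor still
passing through the cubic point, and a nonzero conic through that point contains no rational line.
So at most two lines split off. A curve of degree r ≥ 3 without rational lines has at most (r - 1)q
+ r - 2 points, by counting along a pencil and using tangents (`card_le_of_tangent`). The three
cases give 3q + 2, (q + 1) + (2q + 1) and (2q + 1) + (q + 1).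

Equality (`exists_card_zeros_quartic`): some conic through the cubic point passes through two
rational points, hence is an oval with q + 1 points; multiply it by two lines which miss it. -/

lemma isHomogeneous_of_mul {σ R : Type*} [CommRing R] [IsDomain R] {A B : MvPolynomial σ R}
    {a d : ℕ} (hB : B.IsHomogeneous a) (hB0 : B ≠ 0) (hAB : (A * B).IsHomogeneous (d + a)) :
    A.IsHomogeneous d := by
  let _ : GradedRing (homogeneousSubmodule σ R) := MvPolynomial.gradedAlgebra
  have h1 := DirectSum.coe_decompose_mul_add_of_right_mem (homogeneousSubmodule σ R) (i := d)
    (a := A) (b := B) (j := a) hB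
  have h2 := DirectSum.decompose_of_mem_same (homogeneousSubmodule σ R) (x := A * B) (i := d + a) hAB
  rw [h2] at h1
  have h3 := mul_right_cancel₀ hB0 h1
  rw [h3]
  exact (DirectSum.decompose (homogeneousSubmodule σ R) A d).2

/-! ### Restriction of forms to a line -/

section Restrict

variable {F : Type*} [Field F]

/-- The restriction of a form to the line through two points: the polynomial `G (p + X u)`. -/
noncomputable def restr (p u : Fin 3 → F) : MvPolynomial (Fin 3) F →ₐ[F] Polynomial F :=
  aeval fun i => Polynomial.C (p i) + Polynomial.C (u i) * Polynomial.X

lemma aeval_restr {K : Type*} [Field K] [Algebra F K] (p u : Fin 3 → F) (t : K)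
    (G : MvPolynomial (Fin 3) F) :
    Polynomial.aeval t (restr p u G) =
      aeval (fun i => algebraMap F K (p i) + algebraMap F K (u i) * t) G := by
  have : (Polynomial.aeval t).comp (restr p u) =
      aeval (fun i => algebraMap F K (p i) + algebraMap F K (u i) * t) := by
    ext i
    simp [restr]
  exact DFunLike.congr_fun this G

lemma eval_restr (p u : Fin 3 → F) (t : F) (G : MvPolynomial (Fin 3) F) :
    (restr p u G).eval t = eval (p + t • u) G := by
  have := aeval_restr (K := F) p u t G
  rw [Polynomial.coe_aeval_eq_eval] at this
  rw [this, aeval_eq_eval]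
  congr 2
  ext i
  simp [mul_comm]

lemma restr_monomial (p u : Fin 3 → F) (e : Fin 3 →₀ ℕ) :
    (restr p u (monomial e 1)).natDegree ≤ e.degree ∧
      Polynomial.reflect e.degree (restr p u (monomial e 1)) = restr u p (monomial e 1) := by
  induction e using Finsupp.induction_linear with
  | zero => simp [Polynomial.reflect_one]
  | add e f he hf =>
    have h : (monomial (e + f) 1 : MvPolynomial (Fin 3) F) = monomial e 1 * monomial f 1 := by
      simp [monomial_mul]
    rw [h, map_mul, map_mul, map_add]
    refine ⟨Polynomial.natDegree_mul_le_of_le he.1 hf.1, ?_⟩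
    rw [Polynomial.reflect_mul _ _ he.1 hf.1, he.2, hf.2]
  | single i n =>
    have h : (monomial (Finsupp.single i n) 1 : MvPolynomial (Fin 3) F) = X i ^ n := by
      rw [X_pow_eq_monomial]
    rw [h, map_pow, map_pow, Finsupp.degree_single]
    induction n with
    | zero => simp [Polynomial.reflect_one]
    | succ n ih =>
      have h' : (monomial (Finsupp.single i n) 1 : MvPolynomial (Fin 3) F) = X i ^ n := by
        rw [X_pow_eq_monomial]
      have ih := ih h'
      have h1 : (restr p u (X i)).natDegree ≤ 1 := by
        simp only [restr, aeval_X]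
        compute_degree
      have h2 : Polynomial.reflect 1 (restr p u (X i)) = restr u p (X i) := by
        simp only [restr, aeval_X, Polynomial.reflect_add, Polynomial.reflect_C_mul,
          Polynomial.reflect_C]
        rw [show (Polynomial.X : Polynomial F) = Polynomial.X ^ 1 from (pow_one _).symm,
          Polynomial.reflect_monomial]
        simp [Polynomial.revAt_le, add_comm]
      rw [pow_succ, pow_succ]
      refine ⟨Polynomial.natDegree_mul_le_of_le ih.1 h1, ?_⟩
      rw [Polynomial.reflect_mul _ _ ih.1 h1, ih.2, h2]

/-- Dehomogenizing the binary form `G (s p + t u)` at s = 1 and at t = 1 gives polynomials with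
reversed coefficients. The exchange turns vanishing to order k at `p` into a drop of the degree by
k. -/
lemma restr_isHomogeneous (p u : Fin 3 → F) {G : MvPolynomial (Fin 3) F} {r : ℕ}
    (hG : G.IsHomogeneous r) :
    (restr p u G).natDegree ≤ r ∧ Polynomial.reflect r (restr p u G) = restr u p G := by
  have key : ∀ e ∈ G.support, e.degree = r := fun e he => by
    by_contra hne
    exact (mem_support_iff.1 he) (hG.coeff_eq_zero hne)
  have hmon : ∀ (p u : Fin 3 → F) e, restr p u (monomial e (G.coeff e)) =
      Polynomial.C (G.coeff e) * restr p u (monomial e 1) := fun p u e => by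
    rw [show monomial e (G.coeff e) = C (G.coeff e) * monomial e 1 by simp [C_mul_monomial], map_mul]
    congr 1
    simp [restr, Polynomial.algebraMap_eq]
  have hsum : ∀ p u : Fin 3 → F, restr p u G =
      ∑ e ∈ G.support, Polynomial.C (G.coeff e) * restr p u (monomial e 1) := fun p u => by
    conv_lhs => rw [G.as_sum, map_sum]
    exact Finset.sum_congr rfl fun e _ => hmon p u e
  have hrefl : ∀ (s : Finset (Fin 3 →₀ ℕ)) (f : (Fin 3 →₀ ℕ) → Polynomial F),
      Polynomial.reflect r (∑ e ∈ s, f e) = ∑ e ∈ s, Polynomial.reflect r (f e) := by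
    intro s f
    induction s using Finset.cons_induction with
    | empty => simp
    | cons a s ha ih => rw [Finset.sum_cons, Finset.sum_cons, Polynomial.reflect_add, ih]
  rw [hsum p u, hsum u p, hrefl]
  refine ⟨Polynomial.natDegree_sum_le_of_forall_le _ _ fun e he => ?_,
    Finset.sum_congr rfl fun e he => ?_⟩
  · refine (Polynomial.natDegree_C_mul_le _ _).trans ?_
    rw [← key e he]
    exact (restr_monomial p u e).1
  · rw [Polynomial.reflect_C_mul, ← (restr_monomial p u e).2, key e he]

lemma coeff_restr {p u : Fin 3 → F} {G : MvPolynomial (Fin 3) F} {r : ℕ}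
    (hG : G.IsHomogeneous r) {k : ℕ} (hk : k ≤ r) :
    (restr u p G).coeff (r - k) = (restr p u G).coeff k := by
  rw [← (restr_isHomogeneous p u hG).2, Polynomial.coeff_reflect, Polynomial.revAt_le (by omega)]
  congr 1
  omega

lemma coeff_zero_restr (p u : Fin 3 → F) (G : MvPolynomial (Fin 3) F) :
    (restr p u G).coeff 0 = eval p G := by
  rw [Polynomial.coeff_zero_eq_eval_zero, eval_restr]
  simp

/-- The first-order term of `G (p + X u)` is linear in `u`. -/
lemma exists_gradient (p : Fin 3 → F) (G : MvPolynomial (Fin 3) F) :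
    ∃ g : Fin 3 → F, ∀ u, (restr p u G).coeff 1 = g ⬝ᵥ u := by
  induction G using MvPolynomial.induction_on with
  | C a => exact ⟨0, fun u => by simp [restr, Polynomial.algebraMap_eq]⟩
  | add A B hA hB =>
    obtain ⟨g, hg⟩ := hA
    obtain ⟨h, hh⟩ := hB
    exact ⟨g + h, fun u => by rw [map_add, Polynomial.coeff_add, hg, hh, add_dotProduct]⟩
  | mul_X A i hA =>
    obtain ⟨g, hg⟩ := hA
    refine ⟨p i • g + eval p A • Pi.single i 1, fun u => ?_⟩
    rw [map_mul, Polynomial.coeff_mul, Finset.Nat.antidiagonal_succ]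
    simp [hg, coeff_zero_restr, add_dotProduct, smul_dotProduct]
    simp [restr, Polynomial.coeff_C]
    ring

/-- `G ((1 + X) p) = (1 + X) ^ r G (p)`. This replaces Euler's relation and shows that the line
given by the gradient at a zero `p` passes through `p`. -/
lemma coeff_one_restr_self {p : Fin 3 → F} {G : MvPolynomial (Fin 3) F} {r : ℕ}
    (hG : G.IsHomogeneous r) (hp : eval p G = 0) : (restr p p G).coeff 1 = 0 := by
  have hX : ∀ i, Polynomial.C (p i) + Polynomial.C (p i) * Polynomial.X =
      (1 + Polynomial.X) * Polynomial.C (p i) := fun i => by ring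
  have h : restr p p G = (1 + Polynomial.X) ^ r * Polynomial.C (eval p G) := by
    have : ∀ e, restr p p (monomial e (G.coeff e)) =
        (1 + Polynomial.X) ^ e.degree * Polynomial.C (eval p (monomial e (G.coeff e))) := by
      intro e
      simp only [restr, hX, aeval_monomial, eval_monomial]
      rw [Finsupp.prod_fintype _ _ (by simp), Finsupp.prod_fintype _ _ (by simp)]
      simp only [Finsupp.degree_eq_sum, Fin.prod_univ_three, Fin.sum_univ_three,
        Polynomial.algebraMap_eq, map_mul, map_pow, pow_add, mul_pow]
      ring
    conv_lhs => rw [G.as_sum, map_sum]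
    conv_rhs => rw [G.as_sum, map_sum, map_sum, Finset.mul_sum]
    refine Finset.sum_congr rfl fun e he => ?_
    rw [this]
    by_cases hne : e.degree = r
    · rw [hne]
    · simp [hG.coeff_eq_zero hne]
  rw [h, hp]
  simp

lemma eval_smul_of_isHomogeneous {σ : Type*} {G : MvPolynomial σ F} {r : ℕ}
    (hG : G.IsHomogeneous r) (c : F) (v : σ → F) : eval (c • v) G = c ^ r * eval v G := by
  rw [eval_eq, eval_eq, Finset.mul_sum]
  refine Finset.sum_congr rfl fun e he => ?_
  have hne : e.degree = r := by
    by_contra hne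
    exact (mem_support_iff.1 he) (hG.coeff_eq_zero hne)
  simp only [Pi.smul_apply, smul_eq_mul, mul_pow, Finset.prod_mul_distrib,
    Finset.prod_pow_eq_pow_sum]
  rw [← hne, Finsupp.degree]
  simp only [DFunLike.coe]
  ring

end Restrict

end BlowUpCode

namespace BlowUpCode

open MvPolynomial Matrix

/-! ### Lines, linear forms and splitting off a rational line -/

section Lines

variable {F : Type*} [Field F]

lemma exists_smul_add_smul_eq {p u y : Fin 3 → F} (h : p ⨯₃ u ≠ 0) (hy : y ⬝ᵥ p ⨯₃ u = 0) :
    ∃ a b : F, y = a • p + b • u := by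
  have key : ∀ D α β : F, D ≠ 0 → (∀ i, D * y i = α * p i + β * u i) →
      ∃ a b : F, y = a • p + b • u := fun D α β hD h => by
    refine ⟨α / D, β / D, funext fun i => ?_⟩
    have := h i
    simp only [Pi.add_apply, Pi.smul_apply, smul_eq_mul]
    rw [div_mul_eq_mul_div, div_mul_eq_mul_div, ← add_div, ← this, mul_div_cancel_left₀ _ hD]
  obtain ⟨j, hj⟩ := Function.ne_iff.1 h
  have hj : (p ⨯₃ u) j ≠ 0 := hj
  simp only [cross_apply, vec3_dotProduct, cons_val_zero, cons_val_one, cons_val] at hy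
  -- Cramer's rule with the nonzero coordinate of `p ⨯₃ u` as denominator; `hy` supplies the
  -- remaining equation.
  fin_cases j
  · refine key _ (y 1 * u 2 - y 2 * u 1) (p 1 * y 2 - p 2 * y 1) hj fun i => ?_
    fin_cases i <;> simp [cross_apply] <;> first | linear_combination hy | ring
  · refine key _ (y 2 * u 0 - y 0 * u 2) (p 2 * y 0 - p 0 * y 2) hj fun i => ?_
    fin_cases i <;> simp [cross_apply] <;> first | linear_combination hy | ring
  · refine key _ (y 0 * u 1 - y 1 * u 0) (p 0 * y 1 - p 1 * y 0) hj fun i => ?_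
    fin_cases i <;> simp [cross_apply] <;> first | linear_combination hy | ring

lemma exists_cross_eq {p l : Fin 3 → F} (hp : p ≠ 0) (h : p ⬝ᵥ l = 0) :
    ∃ u, p ⨯₃ u = l := by
  obtain ⟨k, hk⟩ := Function.ne_iff.1 hp
  have hk : p k ≠ 0 := hk
  -- By the triple product formula, p × (l × e_k) = p_k l - (p · l) e_k.
  refine ⟨(p k)⁻¹ • (l ⨯₃ Pi.single k 1), ?_⟩
  simp only [vec3_dotProduct] at h
  ext i
  fin_cases k <;> fin_cases i <;> simp [cross_apply] at hk ⊢ <;> field_simp <;>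
    linear_combination -h

lemma cross_map {K : Type*} [Field K] (f : F →+* K) (p u : Fin 3 → F) :
    (fun i => f (p i)) ⨯₃ (fun i => f (u i)) = fun i => f ((p ⨯₃ u) i) := by
  ext i
  fin_cases i <;> simp [cross_apply]

/-- The linear form with given coefficients. -/
noncomputable def linForm (l : Fin 3 → F) : MvPolynomial (Fin 3) F := ∑ i, C (l i) * X i

lemma aeval_linForm {A : Type*} [CommRing A] [Algebra F A] (l : Fin 3 → F) (v : Fin 3 → A) :
    aeval v (linForm l) = (fun i => algebraMap F A (l i)) ⬝ᵥ v := by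
  simp [linForm, dotProduct]

lemma eval_linForm (l v : Fin 3 → F) : eval v (linForm l) = v ⬝ᵥ l := by
  simp [linForm, dotProduct, mul_comm]

lemma linForm_isHomogeneous (l : Fin 3 → F) : (linForm l).IsHomogeneous 1 :=
  IsHomogeneous.sum _ _ _ fun i _ => isHomogeneous_C_mul_X (l i) i

lemma linForm_ne_zero {l : Fin 3 → F} (hl : l ≠ 0) : linForm l ≠ 0 := by
  intro h
  apply hl
  ext i
  have := eval_linForm l (Pi.single i 1)
  rw [h] at this
  simpa using this.symm

lemma aeval_lincomb_eq_zero {K : Type*} [Field K] [Algebra F K] {p u : Fin 3 → F}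
    {G : MvPolynomial (Fin 3) F} {r : ℕ} (hG : G.IsHomogeneous r) (h : restr p u G = 0) (a b : K) :
    aeval (fun i => a * algebraMap F K (p i) + b * algebraMap F K (u i)) G = 0 := by
  have key : ∀ (p u : Fin 3 → F) (a b : K), restr p u G = 0 → a ≠ 0 →
      aeval (fun i => a * algebraMap F K (p i) + b * algebraMap F K (u i)) G = 0 := by
    intro p u a b h ha
    have h1 := aeval_restr p u (b / a) G
    rw [h, map_zero, aeval_def, ← eval_map] at h1
    rw [aeval_def, ← eval_map]
    have h2 := eval_smul_of_isHomogeneous (hG.map (algebraMap F K)) a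
      (fun i => algebraMap F K (p i) + algebraMap F K (u i) * (b / a))
    rw [← h1, mul_zero] at h2
    rw [← h2]
    congr 2
    ext i
    simp
    field_simp
  by_cases ha : a = 0
  · by_cases hb : b = 0
    -- A form of degree zero need not vanish at the origin, so this case uses `G (p) = 0`.
    · have h0 := coeff_zero_restr p u G
      rw [h, Polynomial.coeff_zero] at h0
      have h2 := eval_smul_of_isHomogeneous (hG.map (algebraMap F K)) (0 : K)
        (fun i => algebraMap F K (p i))
      have h3 : eval (fun i => algebraMap F K (p i)) (map (algebraMap F K) G) = 0 := by
        have h4 := eval₂_comp (algebraMap F K) p G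
        rw [eval_map]
        rw [← h0, map_zero] at h4
        exact h4.symm
      rw [h3, mul_zero] at h2
      have h5 : (fun i => a * algebraMap F K (p i) + b * algebraMap F K (u i)) =
          (0 : K) • fun i => algebraMap F K (p i) := by
        ext i
        simp [ha, hb]
      rw [aeval_def, ← eval_map, h5, h2]
    · have h' : restr u p G = 0 := by
        rw [← (restr_isHomogeneous p u hG).2, h, Polynomial.reflect_zero]
      rw [← key u p b a h' hb]
      congr 2
      ext i
      ring
  · exact key p u a b h ha

/-- A form which vanishes identically on a line is divisible by the equation of the line. -/
lemma exists_eq_linForm_mul {p u : Fin 3 → F} {G : MvPolynomial (Fin 3) F} {r : ℕ}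
    (hG : G.IsHomogeneous (r + 1)) (hpu : p ⨯₃ u ≠ 0) (h : restr p u G = 0) :
    ∃ G' : MvPolynomial (Fin 3) F, G'.IsHomogeneous r ∧ G = linForm (p ⨯₃ u) * G' := by
  set l := p ⨯₃ u with hl
  obtain ⟨j, hj⟩ := Function.ne_iff.1 hpu
  have hj : l j ≠ 0 := hj
  -- `τ` is the projection along the j-th axis onto the plane `l = 0`. It is the identity modulo
  -- `linForm l`, and `G ∘ τ` is zero because `G` vanishes on that plane.
  let c : Fin 3 → F := Pi.single j (l j)⁻¹
  let τ : Fin 3 → MvPolynomial (Fin 3) F := fun i => X i - C (c i) * linForm l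
  have hdvd : linForm l ∣ G - aeval τ G := by
    rw [← Ideal.mem_span_singleton, ← Ideal.Quotient.eq]
    have : (Ideal.Quotient.mkₐ F (Ideal.span {linForm l})).comp (aeval τ) =
        Ideal.Quotient.mkₐ F (Ideal.span {linForm l}) := by
      ext i
      rw [AlgHom.comp_apply, aeval_X, Ideal.Quotient.mkₐ_eq_mk, Ideal.Quotient.eq,
        Ideal.mem_span_singleton]
      exact ⟨-C (c i), by simp only [τ]; ring⟩
    exact (DFunLike.congr_fun this G).symm
  have hzero : aeval τ G = 0 := by
    -- Over a finite field, vanishing at all points would not make a polynomial zero.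
    let K := AlgebraicClosure F
    apply map_injective _ (algebraMap F K).injective
    rw [map_zero]
    refine MvPolynomial.funext fun x => ?_
    have h1 : eval x (map (algebraMap F K) (aeval τ G)) =
        aeval (fun i => aeval x (τ i)) G := by
      rw [eval_map, ← aeval_def, comp_aeval_apply]
    rw [h1, map_zero]
    obtain ⟨a, b, hab⟩ := exists_smul_add_smul_eq (p := fun i => algebraMap F K (p i))
      (u := fun i => algebraMap F K (u i)) (y := fun i => aeval x (τ i)) (by
        rw [cross_map]
        intro h0
        have := congrFun h0 j
        exact hj ((map_eq_zero _).1 this)) (by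
        rw [cross_map, ← hl]
        have h2 : ∀ i, aeval x (τ i) = x i - algebraMap F K (c i) *
            ((fun i => algebraMap F K (l i)) ⬝ᵥ x) := fun i => by
          simp only [τ, map_sub, aeval_X, map_mul, aeval_C, aeval_linForm]
        have h3 : ∑ i, algebraMap F K (c i) * algebraMap F K (l i) = 1 := by
          simp only [← map_mul, ← map_sum]
          simp [c, Pi.single_apply, hj]
        simp only [h2]
        rw [dotProduct]
        simp only [sub_mul]
        rw [Finset.sum_sub_distrib]
        have h4 : ∀ i, algebraMap F K (c i) * ((fun i => algebraMap F K (l i)) ⬝ᵥ x) *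
            algebraMap F K (l i) = (algebraMap F K (c i) * algebraMap F K (l i)) *
            ((fun i => algebraMap F K (l i)) ⬝ᵥ x) := fun i => by ring
        simp only [h4]
        rw [← Finset.sum_mul, h3, one_mul, dotProduct, sub_eq_zero]
        exact Finset.sum_congr rfl fun i _ => mul_comm _ _)
    rw [hab]
    exact aeval_lincomb_eq_zero hG h a b
  rw [hzero, sub_zero] at hdvd
  obtain ⟨G', rfl⟩ := hdvd
  refine ⟨G', isHomogeneous_of_mul (linForm_isHomogeneous l) (linForm_ne_zero hpu) ?_, rfl⟩
  rwa [mul_comm]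

lemma add_smul_ne_zero {p u : Fin 3 → F} (h : p ⨯₃ u ≠ 0) (s : F) : u + s • p ≠ 0 := by
  intro h0
  apply h
  have : p ⨯₃ (u + s • p) = p ⨯₃ u := by simp
  rw [← this, h0, map_zero]

/-- The points on a line in the plane, in terms of two points on it. -/
lemma eq_or_exists_of_orthogonal {p u : Fin 3 → F} (hp : p ≠ 0) (h : p ⨯₃ u ≠ 0)
    {x : ℙ F (Fin 3 → F)} (hx : x.orthogonal (Projectivization.mk F _ h)) :
    x = Projectivization.mk F p hp ∨ ∃ s, x = Projectivization.mk F _ (add_smul_ne_zero h s) := by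
  induction x with | h v hv =>
  rw [Projectivization.orthogonal_mk] at hx
  obtain ⟨a, b, hab⟩ := exists_smul_add_smul_eq h hx
  by_cases hb : b = 0
  · left
    rw [Projectivization.mk_eq_mk_iff']
    exact ⟨a, by rw [hab, hb]; simp⟩
  · right
    refine ⟨a / b, ?_⟩
    rw [Projectivization.mk_eq_mk_iff']
    refine ⟨b, ?_⟩
    rw [hab, smul_add, smul_smul, mul_div_cancel₀ _ hb, add_comm]

/-- In the parametrization `u + s p` the point `p` is at infinity, so contact of order k at `p`
lowers the degree by k. -/
lemma natDegree_restr_le {G : MvPolynomial (Fin 3) F} {r k : ℕ} (hG : G.IsHomogeneous r)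
    (hk : k ≤ r) {p u : Fin 3 → F} (h : ∀ i < k, (restr p u G).coeff i = 0) :
    (restr u p G).natDegree ≤ r - k := by
  rw [Polynomial.natDegree_le_iff_coeff_eq_zero]
  intro n hn
  by_cases hnr : n ≤ r
  · have := coeff_restr hG (p := p) (u := u) (k := r - n) (by omega)
    rw [show r - (r - n) = n by omega] at this
    rw [this]
    exact h _ (by omega)
  · exact Polynomial.coeff_eq_zero_of_natDegree_lt
      ((restr_isHomogeneous u p hG).1.trans_lt (not_le.1 hnr))

lemma rep_cross_rep {x y : ℙ F (Fin 3 → F)} (h : x ≠ y) : x.rep ⨯₃ y.rep ≠ 0 := by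
  rwa [ne_eq, ← Projectivization.mk_eq_mk_iff_crossProduct_eq_zero x.rep_nonzero y.rep_nonzero,
    Projectivization.mk_rep, Projectivization.mk_rep]

/-- A curve contains no rational line. -/
def NoLine (G : MvPolynomial (Fin 3) F) : Prop :=
  ∀ p u : Fin 3 → F, p ⨯₃ u ≠ 0 → restr p u G ≠ 0

/-- A point lies on no rational line. -/
def OffLines (F : Type*) {K : Type*} [Field F] [Field K] [Algebra F K] (v : Fin 3 → K) : Prop :=
  ∀ l : Fin 3 → F, l ≠ 0 → (fun i => algebraMap F K (l i)) ⬝ᵥ v ≠ 0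

lemma exists_linForm_eq {G : MvPolynomial (Fin 3) F} (hG : G.IsHomogeneous 1) : ∃ l, G = linForm l := by
  have h : G ∈ homogeneousSubmodule (Fin 3) F 1 := hG
  rw [homogeneousSubmodule_one_eq_span_X, Submodule.mem_span_range_iff_exists_fun] at h
  obtain ⟨c, hc⟩ := h
  exact ⟨c, by rw [← hc, linForm]; simp [smul_eq_C_mul]⟩

variable {K : Type*} [Field K] [Algebra F K] {v : Fin 3 → K} {G : MvPolynomial (Fin 3) F} {r : ℕ}

/-- The linear factor is rational, hence nonzero at `v`, so the cofactor must vanish there. -/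
lemma exists_factor (hv : OffLines F v) (hG : G.IsHomogeneous (r + 1)) (hGv : aeval v G = 0)
    (hn : ¬ NoLine G) : ∃ (l : Fin 3 → F) (G' : MvPolynomial (Fin 3) F), l ≠ 0 ∧
      G'.IsHomogeneous r ∧ G = linForm l * G' ∧ aeval v G' = 0 := by
  simp only [NoLine, not_forall, not_not] at hn
  obtain ⟨p, u, hpu, h0⟩ := hn
  obtain ⟨G', hG', rfl⟩ := exists_eq_linForm_mul hG hpu h0
  refine ⟨_, G', hpu, hG', rfl, ?_⟩
  rw [map_mul, aeval_linForm] at hGv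
  exact (mul_eq_zero.1 hGv).resolve_left (hv _ hpu)

/-- Splitting off a line would leave a second rational line, through `v`. -/
lemma noLine_conic (hv : OffLines F v) (hG : G.IsHomogeneous 2) (hG0 : G ≠ 0)
    (hGv : aeval v G = 0) : NoLine G := by
  by_contra hn
  obtain ⟨l, G', hl, hG', rfl, hv'⟩ := exists_factor hv hG hGv hn
  obtain ⟨m, rfl⟩ := exists_linForm_eq hG'
  rw [aeval_linForm] at hv'
  refine hv m ?_ hv'
  rintro rfl
  apply hG0
  simp [linForm]

end Lines

/-! ### Rational points of a curve on one line -/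

section Zeros

variable {F : Type*} [Field F] [Finite F]

/-- The rational points of a plane curve. -/
noncomputable def zeros (G : MvPolynomial (Fin 3) F) : Finset (ℙ F (Fin 3 → F)) :=
  (Set.toFinite {x : ℙ F (Fin 3 → F) | eval x.rep G = 0}).toFinset

lemma mk_mem_zeros {G : MvPolynomial (Fin 3) F} {r : ℕ} (hG : G.IsHomogeneous r)
    {v : Fin 3 → F} (hv : v ≠ 0) : Projectivization.mk F v hv ∈ zeros G ↔ eval v G = 0 := by
  obtain ⟨a, ha⟩ := Projectivization.exists_smul_eq_mk_rep F v hv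
  rw [zeros, Set.Finite.mem_toFinset, Set.mem_ofPred_eq, ← ha, Units.smul_def,
    eval_smul_of_isHomogeneous hG]
  simp

lemma mem_zeros {G : MvPolynomial (Fin 3) F} {x : ℙ F (Fin 3 → F)} :
    x ∈ zeros G ↔ eval x.rep G = 0 := by
  simp [zeros]

open Classical in
-- The extra 1 accounts for `p`, the only point of the line not of the form `u + s p`.
lemma card_zeros_line_le {G : MvPolynomial (Fin 3) F} {r : ℕ} (hG : G.IsHomogeneous r)
    {p u : Fin 3 → F} (hp : p ≠ 0) (h : p ⨯₃ u ≠ 0) (h0 : restr u p G ≠ 0) :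
    ((zeros G).filter fun x => x.orthogonal (Projectivization.mk F _ h)).card ≤
      (restr u p G).roots.toFinset.card + 1 := by
  have hsub : ((zeros G).filter fun x => x.orthogonal (Projectivization.mk F _ h)) ⊆
      insert (Projectivization.mk F p hp) ((restr u p G).roots.toFinset.image
        fun s => Projectivization.mk F _ (add_smul_ne_zero h s)) := by
    intro x hx
    rw [Finset.mem_filter] at hx
    rcases eq_or_exists_of_orthogonal hp h hx.2 with rfl | ⟨s, rfl⟩
    · simp
    · refine Finset.mem_insert_of_mem (Finset.mem_image_of_mem _ ?_)
      rw [Multiset.mem_toFinset, Polynomial.mem_roots h0, Polynomial.IsRoot.def, eval_restr]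
      exact (mk_mem_zeros hG _).1 hx.1
  exact (Finset.card_le_card hsub).trans
    ((Finset.card_insert_le _ _).trans (Nat.add_le_add_right Finset.card_image_le 1))

open Classical in
lemma card_zeros_line_le_degree {G : MvPolynomial (Fin 3) F} {r k : ℕ} (hG : G.IsHomogeneous r)
    (hk : k ≤ r) {p u : Fin 3 → F} (hp : p ≠ 0) (h : p ⨯₃ u ≠ 0) (h0 : restr u p G ≠ 0)
    (hc : ∀ i < k, (restr p u G).coeff i = 0) :
    ((zeros G).filter fun x => x.orthogonal (Projectivization.mk F _ h)).card ≤ r - k + 1 :=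
  (card_zeros_line_le hG hp h h0).trans (Nat.add_le_add_right
    ((Multiset.toFinset_card_le _).trans ((Polynomial.card_roots' _).trans
      (natDegree_restr_le hG hk hc))) 1)

open Classical in
/-- A bitangent of a curve of degree `r` meets it in at most `r - 2` points. -/
lemma card_zeros_bitangent_le {G : MvPolynomial (Fin 3) F} {r : ℕ} (hG : G.IsHomogeneous r)
    (hr : 3 ≤ r) {p u : Fin 3 → F} (hp : p ≠ 0) (h : p ⨯₃ u ≠ 0) (h0 : restr u p G ≠ 0)
    (hc : ∀ i < 2, (restr p u G).coeff i = 0) (hc' : ∀ i < 2, (restr u p G).coeff i = 0) :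
    ((zeros G).filter fun x => x.orthogonal (Projectivization.mk F _ h)).card ≤ r - 2 := by
  have hX : Polynomial.X ^ 2 ∣ restr u p G := Polynomial.X_pow_dvd_iff.2 hc'
  obtain ⟨f, hf⟩ := hX
  have hf0 : f ≠ 0 := by rintro rfl; simp [hf] at h0
  have hdeg := natDegree_restr_le hG (by omega) hc
  have hroots : (restr u p G).roots.toFinset ⊆ insert 0 f.roots.toFinset := by
    intro s hs
    rw [Multiset.mem_toFinset, Polynomial.mem_roots h0, Polynomial.IsRoot.def, hf] at hs
    simp only [Polynomial.eval_mul, Polynomial.eval_pow, Polynomial.eval_X, mul_eq_zero,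
      pow_eq_zero_iff, ne_eq, OfNat.ofNat_ne_zero, not_false_eq_true] at hs
    rcases hs with rfl | hs
    · simp
    · exact Finset.mem_insert_of_mem (by simpa [hf0] using hs)
  have hfd : f.natDegree + 2 ≤ r - 2 := by
    rw [hf, Polynomial.natDegree_mul (by simp) hf0, Polynomial.natDegree_X_pow] at hdeg
    omega
  have h1 := card_zeros_line_le hG hp h h0
  have h2 := (Finset.card_le_card hroots).trans (Finset.card_insert_le _ _)
  have h3 := (Multiset.toFinset_card_le f.roots).trans (Polynomial.card_roots' f)
  omega

end Zeros

end BlowUpCode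

namespace BlowUpCode

/-! ### Counting in a finite projective plane -/

section ProjectivePlane

open Configuration Classical

variable {P L : Type*} [Membership P L] [ProjectivePlane P L] [Fintype P] [Fintype L]

/-- The number of points of a set on a given line. -/
noncomputable def numOn (S : Finset P) (l : L) : ℕ := (S.filter (· ∈ l)).card

lemma card_pencil (p : P) :
    (Finset.univ.filter fun l : L => p ∈ l).card = ProjectivePlane.order P L + 1 := by
  rw [← ProjectivePlane.lineCount_eq (L := L) p, lineCount, Nat.card_eq_fintype_card,
    Fintype.card_subtype]

lemma card_points_on (l : L) :
    (Finset.univ.filter fun p : P => p ∈ l).card = ProjectivePlane.order P L + 1 := by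
  rw [← ProjectivePlane.pointCount_eq (P := P) l, pointCount, Nat.card_eq_fintype_card,
    Fintype.card_subtype]

lemma card_lines_through {P L : Type*} [Membership P L] [ProjectivePlane P L] [Fintype L]
    {p x : P} (h : p ≠ x) :
    (Finset.univ.filter fun l : L => p ∈ l ∧ x ∈ l).card = 1 := by
  obtain ⟨l, hl, hu⟩ := HasLines.existsUnique_line P L p x h
  rw [Finset.card_eq_one]
  refine ⟨l, ?_⟩
  ext m
  simp only [Finset.mem_filter, Finset.mem_univ, true_and, Finset.mem_singleton]
  exact ⟨fun hm => hu m hm, fun hm => hm ▸ hl⟩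

/-- Counting the points of a set on the lines through one of its points. -/
lemma sum_pencil_numOn {S : Finset P} {p : P} (hp : p ∈ S) :
    ∑ l ∈ Finset.univ.filter (fun l : L => p ∈ l), numOn S l =
      S.card + ProjectivePlane.order P L := by
  simp only [numOn, Finset.card_eq_sum_ones, Finset.sum_filter]
  have h1 : ∀ l : L, (if p ∈ l then ∑ x ∈ S, if x ∈ l then 1 else 0 else 0) =
      ∑ x ∈ S, if p ∈ l ∧ x ∈ l then 1 else 0 := fun l => by
    by_cases h : p ∈ l <;> simp [h]
  simp only [h1]
  rw [Finset.sum_comm]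
  simp only [← Finset.sum_filter, ← Finset.card_eq_sum_ones]
  rw [← Finset.add_sum_erase S _ hp]
  simp only [and_self]
  rw [card_pencil, Finset.sum_congr rfl fun x hx =>
    card_lines_through (L := L) (Finset.ne_of_mem_erase hx).symm]
  have := Finset.card_erase_add_one hp
  rw [← Finset.card_eq_sum_ones]
  omega

lemma sum_numOn (S : Finset P) :
    ∑ l : L, numOn S l = S.card * (ProjectivePlane.order P L + 1) := by
  simp only [numOn, Finset.card_eq_sum_ones, Finset.sum_filter]
  rw [Finset.sum_comm]
  simp only [← Finset.sum_filter, ← Finset.card_eq_sum_ones, card_pencil]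
  rw [Finset.sum_const, smul_eq_mul, Finset.card_eq_sum_ones]

lemma sum_numOn_sq (S : Finset P) :
    ∑ l : L, numOn S l * numOn S l = S.card * (S.card + ProjectivePlane.order P L) := by
  have h1 : ∀ l : L, numOn S l * numOn S l = ∑ x ∈ S, if x ∈ l then numOn S l else 0 := fun l => by
    rw [← Finset.sum_filter, Finset.sum_const, smul_eq_mul]
    rfl
  simp only [h1]
  rw [Finset.sum_comm]
  simp only [← Finset.sum_filter]
  rw [Finset.sum_congr rfl fun x hx => sum_pencil_numOn (L := L) hx, Finset.sum_const, smul_eq_mul]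

/-- The pencil at `p` counts `p` once per line and every other point of `S` once. Each line
contributes at most r, and each line of `A` saves one. -/
lemma card_le_of_pencil {S : Finset P} {p : P} (hp : p ∈ S) {r : ℕ}
    (hle : ∀ l : L, p ∈ l → numOn S l ≤ r) (A : Finset L)
    (hA : ∀ l ∈ A, p ∈ l ∧ numOn S l + 1 ≤ r) :
    S.card + ProjectivePlane.order P L + A.card ≤ (ProjectivePlane.order P L + 1) * r := by
  have hcard : A.card = ∑ l ∈ Finset.univ.filter (fun l : L => p ∈ l), if l ∈ A then 1 else 0 := by
    rw [← Finset.sum_filter, ← Finset.card_eq_sum_ones]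
    congr 1
    ext l
    simp only [Finset.mem_filter, Finset.mem_univ, true_and]
    exact ⟨fun h => ⟨(hA l h).1, h⟩, fun h => h.2⟩
  rw [← sum_pencil_numOn (L := L) hp, hcard, ← Finset.sum_add_distrib, ← card_pencil (L := L) p,
    ← smul_eq_mul, ← Finset.sum_const]
  refine Finset.sum_le_sum fun l hl => ?_
  rw [Finset.mem_filter] at hl
  split_ifs with h
  · exact (hA l h).2
  · exact hle l hl.2

/-- A bound for point sets of degree `r` with tangents. -/
lemma card_le_of_tangent {S : Finset P} {r : ℕ} (hr : 3 ≤ r) (tan : P → L → Prop)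
    (hle : ∀ p ∈ S, ∀ l : L, p ∈ l → numOn S l ≤ r)
    (hex : ∀ p ∈ S, ∃ l : L, p ∈ l ∧ tan p l)
    (htan : ∀ p ∈ S, ∀ l : L, p ∈ l → tan p l → numOn S l + 1 ≤ r)
    (hbitan : ∀ p ∈ S, ∀ p' ∈ S, p ≠ p' → ∀ l : L, p ∈ l → p' ∈ l → tan p l → tan p' l →
      numOn S l + 2 ≤ r) :
    S.card + ProjectivePlane.order P L + 2 ≤ (ProjectivePlane.order P L + 1) * r := by
  rcases S.eq_empty_or_nonempty with rfl | ⟨p, hp⟩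
  · simp only [Finset.card_empty]
    nlinarith
  obtain ⟨l, hpl, hl⟩ := hex p hp
  -- Two must be saved from the pencil bound. A tangent with at most r - 2 points does this alone.
  by_cases hone : numOn S l + 2 ≤ r
  · have h := sum_pencil_numOn (L := L) hp
    have hmem : l ∈ Finset.univ.filter (fun l : L => p ∈ l) := by simpa using hpl
    have h2 : ∑ m ∈ (Finset.univ.filter (fun l : L => p ∈ l)).erase l, numOn S m ≤
        ((Finset.univ.filter (fun l : L => p ∈ l)).erase l).card • r :=
      Finset.sum_le_card_nsmul _ _ _ fun m hm =>
        hle p hp m (Finset.mem_filter.1 (Finset.mem_of_mem_erase hm)).2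
    rw [← Finset.add_sum_erase _ _ hmem] at h
    rw [Finset.card_erase_of_mem hmem, card_pencil, Nat.add_sub_cancel, smul_eq_mul] at h2
    nlinarith
  -- Otherwise `l` has at least r - 1 ≥ 2 points. Take another one, `p'`: since `l` is no bitangent,
  -- the tangent `l'` at `p'` differs from `l`, and in the pencil at `p'` both lines save one.
  · have hone' : 1 < (S.filter (· ∈ l)).card := by
      change 1 < numOn S l
      omega
    obtain ⟨p', hp', hne⟩ := Finset.exists_mem_ne hone' p
    rw [Finset.mem_filter] at hp'
    obtain ⟨l', hpl', hl'⟩ := hex p' hp'.1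
    have hll : l ≠ l' := by
      rintro rfl
      exact hone (hbitan p hp p' hp'.1 hne.symm l hpl hp'.2 hl hl')
    have h := card_le_of_pencil hp'.1 (hle p' hp'.1) {l, l'} (by
      intro m hm
      rw [Finset.mem_insert, Finset.mem_singleton] at hm
      rcases hm with rfl | rfl
      · exact ⟨hp'.2, htan p hp _ hpl hl⟩
      · exact ⟨hpl', htan p' hp'.1 _ hpl' hl'⟩)
    rwa [Finset.card_pair hll] at h

/-- Every line of the pencil other than `t` carries a second point of `S`, and distinct lines carry
distinct ones. -/
lemma order_add_one_le_card {S : Finset P} {p : P} (hp : p ∈ S) (t : L)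
    (h : ∀ l : L, p ∈ l → l ≠ t → 2 ≤ numOn S l) : ProjectivePlane.order P L + 1 ≤ S.card := by
  have h1 : (Finset.univ.filter fun l : L => p ∈ l).card • 2 ≤
      ∑ l ∈ Finset.univ.filter (fun l : L => p ∈ l), (numOn S l + if l = t then 1 else 0) := by
    refine Finset.card_nsmul_le_sum _ _ _ fun l hl => ?_
    rw [Finset.mem_filter] at hl
    split_ifs with hlt
    · have : 0 < numOn S l := Finset.card_pos.2 ⟨p, Finset.mem_filter.2 ⟨hp, hl.2⟩⟩
      omega
    · exact h l hl.2 hlt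
  rw [Finset.sum_add_distrib, sum_pencil_numOn hp, card_pencil, smul_eq_mul] at h1
  have h2 : ∑ l ∈ Finset.univ.filter (fun l : L => p ∈ l), (if l = t then 1 else 0) ≤ 1 := by
    rw [Finset.sum_ite_eq']
    split_ifs <;> simp
  omega

/-- The number of external lines of an oval. -/
lemma card_external_lines {S : Finset P} (hS : S.card = ProjectivePlane.order P L + 1)
    (hle : ∀ l : L, numOn S l ≤ 2) :
    2 * (Finset.univ.filter fun l : L => numOn S l = 0).card + ProjectivePlane.order P L =
      ProjectivePlane.order P L ^ 2 := by
  have h1 := sum_numOn (L := L) S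
  have h2 := sum_numOn_sq (L := L) S
  have h3 := ProjectivePlane.card_lines P L
  -- For n ≤ 2, n² + 2 = 3n + 2·[n = 0], because (n - 1)(n - 2) is 2 at 0 and vanishes at 1 and 2.
  have h4 : ∑ l : L, numOn S l * numOn S l + 2 * Fintype.card L =
      3 * ∑ l : L, numOn S l + 2 * (Finset.univ.filter fun l : L => numOn S l = 0).card := by
    rw [Finset.card_filter, ← Finset.card_univ, Finset.card_eq_sum_ones, Finset.mul_sum,
      Finset.mul_sum, Finset.mul_sum, ← Finset.sum_add_distrib, ← Finset.sum_add_distrib]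
    refine Finset.sum_congr rfl fun l _ => ?_
    have := hle l
    interval_cases numOn S l <;> simp
  rw [h1, h2, h3, hS] at h4
  nlinarith

lemma card_union_lines {l l' : L} (h : l ≠ l') :
    (Finset.univ.filter fun p : P => p ∈ l ∨ p ∈ l').card =
      2 * ProjectivePlane.order P L + 1 := by
  obtain ⟨p, hp, hu⟩ := HasPoints.existsUnique_point P L l l' h
  have h1 := Finset.card_union_add_card_inter (Finset.univ.filter fun p : P => p ∈ l)
    (Finset.univ.filter fun p : P => p ∈ l')
  have h2 : (Finset.univ.filter fun p : P => p ∈ l) ∩ (Finset.univ.filter fun p : P => p ∈ l') =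
      {p} := by
    ext x
    simp only [Finset.mem_inter, Finset.mem_filter, Finset.mem_univ, true_and,
      Finset.mem_singleton]
    exact ⟨fun hx => hu x hx, fun hx => hx ▸ hp⟩
  rw [h2, ← Finset.filter_or, card_points_on, card_points_on, Finset.card_singleton] at h1
  omega

end ProjectivePlane

end BlowUpCode

namespace BlowUpCode

/-! ### Tangents and numbers of points of plane curves -/

section Curves

open MvPolynomial Matrix Configuration Classical

variable {F : Type*} [Field F]

lemma rep_dotProduct_rep {x l : ℙ F (Fin 3 → F)} (h : x ∈ l) : x.rep ⬝ᵥ l.rep = 0 := by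
  rw [Configuration.ofField.mem_iff] at h
  rwa [← Projectivization.orthogonal_mk x.rep_nonzero l.rep_nonzero, Projectivization.mk_rep,
    Projectivization.mk_rep]

lemma exists_rep_cross {x l : ℙ F (Fin 3 → F)} (h : x ∈ l) :
    ∃ (u : Fin 3 → F) (hu : x.rep ⨯₃ u ≠ 0), Projectivization.mk F _ hu = l ∧ u ⬝ᵥ l.rep = 0 := by
  obtain ⟨u, hu⟩ := exists_cross_eq x.rep_nonzero (rep_dotProduct_rep h)
  refine ⟨u, hu ▸ l.rep_nonzero, ?_, by rw [← hu, dot_cross_self]⟩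
  simp only [hu, Projectivization.mk_rep]

lemma mk_rep_cross_rep {x y l : ℙ F (Fin 3 → F)} (h : x ≠ y) (hx : x ∈ l) (hy : y ∈ l) :
    Projectivization.mk F _ (rep_cross_rep h) = l := by
  obtain ⟨m, -, hu⟩ := HasLines.existsUnique_line (ℙ F (Fin 3 → F)) (ℙ F (Fin 3 → F)) x y h
  rw [hu l ⟨hx, hy⟩]
  refine hu _ ⟨?_, ?_⟩
  · rw [Configuration.ofField.mem_iff]
    conv_lhs => rw [← Projectivization.mk_rep x]
    rw [Projectivization.orthogonal_mk, dot_self_cross]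
  · rw [Configuration.ofField.mem_iff]
    conv_lhs => rw [← Projectivization.mk_rep y]
    rw [Projectivization.orthogonal_mk, dot_cross_self]

variable [Finite F]

noncomputable local instance : Fintype (ℙ F (Fin 3 → F)) := Fintype.ofFinite _

lemma natCard_plane (F : Type*) [Field F] [Finite F] :
    Nat.card (ℙ F (Fin 3 → F)) = Nat.card F ^ 2 + Nat.card F + 1 := by
  rw [Projectivization.card_of_finrank (n := 3) F (Fin 3 → F) (by simp)]
  simp [Finset.sum_range_succ]
  ring

lemma order_plane :
    ProjectivePlane.order (ℙ F (Fin 3 → F)) (ℙ F (Fin 3 → F)) = Nat.card F := by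
  have h1 := ProjectivePlane.card_points (ℙ F (Fin 3 → F)) (ℙ F (Fin 3 → F))
  rw [← Nat.card_eq_fintype_card, natCard_plane] at h1
  nlinarith

/-- The line `l` is tangent at `x` to the curve (or `x` is a singular point). -/
def IsTangent (G : MvPolynomial (Fin 3) F) (x l : ℙ F (Fin 3 → F)) : Prop :=
  ∀ u, u ⬝ᵥ l.rep = 0 → (restr x.rep u G).coeff 1 = 0

variable {G : MvPolynomial (Fin 3) F} {r : ℕ}

lemma coeff_zero_of_mem_zeros {x : ℙ F (Fin 3 → F)} (hx : x ∈ zeros G) (u : Fin 3 → F) :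
    (restr x.rep u G).coeff 0 = 0 := by
  rw [coeff_zero_restr, mem_zeros.1 hx]

lemma exists_isTangent (hG : G.IsHomogeneous r) {x : ℙ F (Fin 3 → F)} (hx : x ∈ zeros G) :
    ∃ l, x ∈ l ∧ IsTangent G x l := by
  obtain ⟨g, hg⟩ := exists_gradient x.rep G
  -- At a singular point every line through `x` counts as tangent; otherwise the gradient is the
  -- tangent line.
  by_cases h0 : g = 0
  · obtain ⟨y, hy⟩ : ∃ y, y ≠ x := by
      have := ProjectivePlane.card_points (ℙ F (Fin 3 → F)) (ℙ F (Fin 3 → F))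
      have h1 := ProjectivePlane.one_lt_order (ℙ F (Fin 3 → F)) (ℙ F (Fin 3 → F))
      have : Nontrivial (ℙ F (Fin 3 → F)) := by
        rw [← Fintype.one_lt_card_iff_nontrivial]
        omega
      exact exists_ne x
    obtain ⟨l, hl, -⟩ := HasLines.existsUnique_line (ℙ F (Fin 3 → F)) (ℙ F (Fin 3 → F)) x y hy.symm
    exact ⟨l, hl.1, fun u _ => by rw [hg, h0, zero_dotProduct]⟩
  · refine ⟨Projectivization.mk F g h0, ?_, fun u hu => ?_⟩
    · rw [Configuration.ofField.mem_iff]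
      conv_lhs => rw [← Projectivization.mk_rep x]
      rw [Projectivization.orthogonal_mk, dotProduct_comm, ← hg]
      exact coeff_one_restr_self hG (mem_zeros.1 hx)
    · obtain ⟨a, ha⟩ := Projectivization.exists_smul_eq_mk_rep F g h0
      rw [← ha, Units.smul_def, dotProduct_smul, smul_eq_mul, dotProduct_comm] at hu
      rw [hg]
      simpa using hu

lemma numOn_zeros_le (hG : G.IsHomogeneous r) (hr : 1 ≤ r) (hn : NoLine G)
    {x l : ℙ F (Fin 3 → F)} (hx : x ∈ zeros G) (hxl : x ∈ l) : numOn (zeros G) l ≤ r := by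
  obtain ⟨u, hu, rfl, -⟩ := exists_rep_cross hxl
  have := card_zeros_line_le_degree hG hr x.rep_nonzero hu (by
    refine hn _ _ ?_
    rwa [← cross_anticomm, neg_ne_zero]) (fun i hi => by
    rw [Nat.lt_one_iff.1 hi]; exact coeff_zero_of_mem_zeros hx u)
  rw [Nat.sub_add_cancel hr] at this
  exact this

lemma numOn_zeros_le_of_isTangent (hG : G.IsHomogeneous r) (hr : 2 ≤ r) (hn : NoLine G)
    {x l : ℙ F (Fin 3 → F)} (hx : x ∈ zeros G) (hxl : x ∈ l) (ht : IsTangent G x l) :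
    numOn (zeros G) l + 1 ≤ r := by
  obtain ⟨u, hu, hl, hul⟩ := exists_rep_cross hxl
  have := card_zeros_line_le_degree hG hr x.rep_nonzero hu (by
    refine hn _ _ ?_
    rwa [← cross_anticomm, neg_ne_zero]) (fun i hi => by
    interval_cases i
    · exact coeff_zero_of_mem_zeros hx u
    · exact ht u hul)
  rw [hl] at this
  have h2 : numOn (zeros G) l ≤ r - 2 + 1 := this
  omega

lemma numOn_zeros_le_of_bitangent (hG : G.IsHomogeneous r) (hr : 3 ≤ r) (hn : NoLine G)
    {x y l : ℙ F (Fin 3 → F)} (hx : x ∈ zeros G) (hy : y ∈ zeros G) (hxy : x ≠ y)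
    (hxl : x ∈ l) (hyl : y ∈ l) (hx' : IsTangent G x l) (hy' : IsTangent G y l) :
    numOn (zeros G) l + 2 ≤ r := by
  have := card_zeros_bitangent_le hG hr x.rep_nonzero (rep_cross_rep hxy) (by
    refine hn _ _ ?_
    rw [← cross_anticomm, neg_ne_zero]
    exact rep_cross_rep hxy) (fun i hi => by
    interval_cases i
    · exact coeff_zero_of_mem_zeros hx _
    · exact hx' _ (rep_dotProduct_rep hyl)) (fun i hi => by
    interval_cases i
    · exact coeff_zero_of_mem_zeros hy _
    · exact hy' _ (rep_dotProduct_rep hxl))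
  rw [mk_rep_cross_rep hxy hxl hyl] at this
  have h2 : numOn (zeros G) l ≤ r - 2 := this
  omega

/-- A curve of degree `r ≥ 3` without rational lines has at most `(r - 1) q + r - 2` rational
points. -/
lemma card_zeros_le_of_noLine (hG : G.IsHomogeneous r) (hr : 3 ≤ r) (hn : NoLine G) :
    (zeros G).card + Nat.card F + 2 ≤ (Nat.card F + 1) * r := by
  rw [← order_plane]
  exact card_le_of_tangent hr (IsTangent G)
    (fun p hp l hl => numOn_zeros_le hG (by omega) hn hp hl)
    (fun p hp => exists_isTangent hG hp)
    (fun p hp l hl ht => numOn_zeros_le_of_isTangent hG (by omega) hn hp hl ht)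
    (fun p hp p' hp' hne l hl hl' ht ht' =>
      numOn_zeros_le_of_bitangent hG hr hn hp hp' hne hl hl' ht ht')

lemma card_zeros_conic_le (hG : G.IsHomogeneous 2) (hn : NoLine G) :
    (zeros G).card ≤ Nat.card F + 1 := by
  rcases (zeros G).eq_empty_or_nonempty with h | ⟨x, hx⟩
  · simp [h]
  obtain ⟨l, hl, ht⟩ := exists_isTangent hG hx
  have := card_le_of_pencil hx (r := 2) (fun l hl => numOn_zeros_le hG (by omega) hn hx hl) {l} (by
    intro m hm
    rw [Finset.mem_singleton.1 hm]
    exact ⟨hl, numOn_zeros_le_of_isTangent hG le_rfl hn hx hl ht⟩)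
  rw [order_plane, Finset.card_singleton] at this
  omega

/-- A conic without rational lines which has two rational points has `q + 1` of them. -/
lemma card_zeros_conic (hG : G.IsHomogeneous 2) (hn : NoLine G) {x y : ℙ F (Fin 3 → F)}
    (hx : x ∈ zeros G) (hy : y ∈ zeros G) (hxy : x ≠ y) :
    (zeros G).card = Nat.card F + 1 := by
  refine (card_zeros_conic_le hG hn).antisymm ?_
  rw [← order_plane]
  obtain ⟨g, hg⟩ := exists_gradient x.rep G
  -- A conic singular at `x` has a double zero there on the line joining `x` and `y`, and a third
  -- zero at `y`, so it would contain that line.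
  have hg0 : g ≠ 0 := by
    rintro rfl
    have h1 : restr y.rep x.rep G = 0 := by
      have hdeg := natDegree_restr_le hG le_rfl (p := x.rep) (u := y.rep) (fun i hi => by
        interval_cases i
        · exact coeff_zero_of_mem_zeros hx _
        · rw [hg, zero_dotProduct])
      rw [Polynomial.eq_C_of_natDegree_le_zero hdeg, coeff_zero_of_mem_zeros hy, map_zero]
    exact hn _ _ (rep_cross_rep hxy.symm) h1
  have key : ∀ l, x ∈ l → l ≠ Projectivization.mk F g hg0 → 2 ≤ numOn (zeros G) l := by
    intro l hl hne
    obtain ⟨u, hu, hul, hu0⟩ := exists_rep_cross hl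
    -- If this were zero, `l` would join `x` and `u` inside the tangent line, hence equal it.
    have hgu : g ⬝ᵥ u ≠ 0 := by
      intro h0
      have hgx : x ∈ Projectivization.mk F g hg0 := by
        rw [Configuration.ofField.mem_iff]
        conv_lhs => rw [← Projectivization.mk_rep x]
        rw [Projectivization.orthogonal_mk, dotProduct_comm, ← hg]
        exact coeff_one_restr_self hG (mem_zeros.1 hx)
      have hu1 : u ≠ 0 := by rintro rfl; simp at hu
      have hgu : Projectivization.mk F u hu1 ∈ Projectivization.mk F g hg0 := by
        rw [Configuration.ofField.mem_iff, Projectivization.orthogonal_mk, dotProduct_comm, h0]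
      have hlu : Projectivization.mk F u hu1 ∈ l := by
        rw [← hul, Configuration.ofField.mem_iff, Projectivization.orthogonal_mk, dot_cross_self]
      have hxu : x ≠ Projectivization.mk F u hu1 := by
        intro h
        rw [← Projectivization.mk_rep x,
          Projectivization.mk_eq_mk_iff_crossProduct_eq_zero] at h
        exact hu h
      exact hne ((mk_rep_cross_rep hxu hl hlu).symm.trans (mk_rep_cross_rep hxu hgx hgu))
    have hc1 : (restr u x.rep G).coeff 1 = g ⬝ᵥ u := by
      rw [← hg, ← coeff_restr hG (k := 1) (by omega)]
    have hdeg := natDegree_restr_le hG (k := 1) (by omega) (p := x.rep) (u := u) (fun i hi => by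
        rw [Nat.lt_one_iff.1 hi]; exact coeff_zero_of_mem_zeros hx _)
    -- As `G` vanishes at `x`, `restr u x.rep G` has degree at most 1, with coefficient `g ⬝ᵥ u` of
    -- X. Its root `s` gives the second point of the conic on `l`.
    set s := -(restr u x.rep G).coeff 0 / (g ⬝ᵥ u) with hs
    have hroot : eval (u + s • x.rep) G = 0 := by
      rw [← eval_restr, Polynomial.eq_X_add_C_of_natDegree_le_one hdeg, hc1]
      simp only [Polynomial.eval_add, Polynomial.eval_mul, Polynomial.eval_C, Polynomial.eval_X, hs]
      field_simp
      ring
    have hz := add_smul_ne_zero hu s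
    have hsub : {x, Projectivization.mk F _ hz} ⊆ (zeros G).filter (· ∈ l) := by
      intro z hz'
      rw [Finset.mem_insert, Finset.mem_singleton] at hz'
      rw [Finset.mem_filter]
      rcases hz' with rfl | rfl
      · exact ⟨hx, hl⟩
      · refine ⟨(mk_mem_zeros hG hz).2 hroot, ?_⟩
        rw [← hul, Configuration.ofField.mem_iff, Projectivization.orthogonal_mk]
        simp [add_dotProduct, smul_dotProduct]
    have hne' : x ≠ Projectivization.mk F _ hz := by
      intro h
      have h' := (Projectivization.mk_rep x).trans h
      rw [Projectivization.mk_eq_mk_iff_crossProduct_eq_zero] at h'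
      apply hu
      simpa using h'
    have := Finset.card_le_card hsub
    rwa [Finset.card_pair hne'] at this
  exact order_add_one_le_card hx _ key

lemma zeros_mul {A B : MvPolynomial (Fin 3) F} : zeros (A * B) = zeros A ∪ zeros B := by
  ext x
  simp [mem_zeros]

lemma mem_zeros_linForm {l : Fin 3 → F} (hl : l ≠ 0) {x : ℙ F (Fin 3 → F)} :
    x ∈ zeros (linForm l) ↔ x ∈ Projectivization.mk F l hl := by
  rw [mem_zeros, eval_linForm, Configuration.ofField.mem_iff]
  conv_rhs => rw [← Projectivization.mk_rep x]
  rw [Projectivization.orthogonal_mk]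

lemma card_zeros_linForm {l : Fin 3 → F} (hl : l ≠ 0) :
    (zeros (linForm l)).card = Nat.card F + 1 := by
  rw [← order_plane, ← card_points_on (Projectivization.mk F l hl)]
  congr 1
  ext x
  simp [mem_zeros_linForm hl]

lemma card_zeros_linForm_mul {l m : Fin 3 → F} (hl : l ≠ 0) (hm : m ≠ 0)
    (h : Projectivization.mk F l hl ≠ Projectivization.mk F m hm) :
    (zeros (linForm l * linForm m)).card = 2 * Nat.card F + 1 := by
  rw [← order_plane, ← card_union_lines h, zeros_mul]
  congr 1
  ext x
  simp [mem_zeros_linForm hl, mem_zeros_linForm hm]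

lemma card_zeros_linForm_mul_le {l m : Fin 3 → F} (hl : l ≠ 0) (hm : m ≠ 0) :
    (zeros (linForm l * linForm m)).card ≤ 2 * Nat.card F + 1 := by
  by_cases h : Projectivization.mk F l hl = Projectivization.mk F m hm
  · have : zeros (linForm l * linForm m) = zeros (linForm l) := by
      rw [zeros_mul]
      ext x
      simp [mem_zeros_linForm hl, mem_zeros_linForm hm, h]
    rw [this, card_zeros_linForm hl]
    omega
  · exact (card_zeros_linForm_mul hl hm h).le

/-! ### Quartics through the cubic point -/

section Through

variable {K : Type*} [Field K] [Algebra F K] {v : Fin 3 → K}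

/-- A quartic through a point of degree three which is on no rational line has at most `3 q + 2`
rational points. -/
theorem card_zeros_quartic_le (hv : OffLines F v) (hG : G.IsHomogeneous 4) (hG0 : G ≠ 0)
    (hGv : aeval v G = 0) : (zeros G).card ≤ 3 * Nat.card F + 2 := by
  by_cases hn : NoLine G
  · have := card_zeros_le_of_noLine hG (by omega) hn
    linarith
  obtain ⟨l, G', hl, hG', rfl, hv'⟩ := exists_factor hv hG hGv hn
  have hG0' := right_ne_zero_of_mul hG0
  by_cases hn' : NoLine G'
  · have h1 := card_zeros_le_of_noLine hG' le_rfl hn'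
    have h2 := Finset.card_union_le (zeros (linForm l)) (zeros G')
    rw [zeros_mul]
    rw [card_zeros_linForm hl] at h2
    linarith
  obtain ⟨m, G'', hm, hG'', rfl, hv''⟩ := exists_factor hv hG' hv' hn'
  have h1 := card_zeros_conic_le hG'' (noLine_conic hv hG'' (right_ne_zero_of_mul hG0') hv'')
  have h2 := Finset.card_union_le (zeros (linForm l * linForm m)) (zeros G'')
  have h3 := card_zeros_linForm_mul_le hl hm
  rw [← mul_assoc, zeros_mul]
  linarith

/-- The bound is attained by the product of a conic and two external lines. -/
theorem exists_card_zeros_quartic (hv : OffLines F v) {Q : MvPolynomial (Fin 3) F}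
    (hQ : Q.IsHomogeneous 2) (hQ0 : Q ≠ 0) (hQv : aeval v Q = 0) {x y : ℙ F (Fin 3 → F)}
    (hx : x ∈ zeros Q) (hy : y ∈ zeros Q) (hxy : x ≠ y) (hF : 3 ≤ Nat.card F) :
    ∃ G : MvPolynomial (Fin 3) F, G.IsHomogeneous 4 ∧ aeval v G = 0 ∧ G ≠ 0 ∧
      (zeros G).card = 3 * Nat.card F + 2 := by
  have hn := noLine_conic hv hQ hQ0 hQv
  have hcard := card_zeros_conic hQ hn hx hy hxy
  have h1 := card_external_lines (hcard.trans (by rw [order_plane])) (fun l : ℙ F (Fin 3 → F) => by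
    rcases ((zeros Q).filter (· ∈ l)).eq_empty_or_nonempty with h | ⟨z, hz⟩
    · rw [numOn, h]; simp
    · rw [Finset.mem_filter] at hz
      exact numOn_zeros_le hQ (by omega) hn hz.1 hz.2)
  rw [order_plane] at h1
  -- The oval has q(q - 1)/2 external lines, which exceeds 1 once q ≥ 3.
  have h2 : 1 < (Finset.univ.filter fun l : ℙ F (Fin 3 → F) => numOn (zeros Q) l = 0).card := by
    by_contra hlt
    nlinarith
  obtain ⟨l, hl, m, hm, hlm⟩ := Finset.one_lt_card.1 h2
  rw [Finset.mem_filter] at hl hm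
  have hlm' : Projectivization.mk F l.rep l.rep_nonzero ≠
      Projectivization.mk F m.rep m.rep_nonzero := by
    rwa [Projectivization.mk_rep, Projectivization.mk_rep]
  refine ⟨linForm l.rep * linForm m.rep * Q,
    ((linForm_isHomogeneous _).mul (linForm_isHomogeneous _)).mul hQ, by simp [hQv],
    mul_ne_zero (mul_ne_zero (linForm_ne_zero l.rep_nonzero) (linForm_ne_zero m.rep_nonzero)) hQ0,
    ?_⟩
  rw [zeros_mul, Finset.card_union_of_disjoint, hcard,
    card_zeros_linForm_mul l.rep_nonzero m.rep_nonzero hlm']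
  · omega
  · rw [Finset.disjoint_right]
    intro z hz hz'
    rw [zeros_mul, Finset.mem_union, mem_zeros_linForm l.rep_nonzero,
      mem_zeros_linForm m.rep_nonzero, Projectivization.mk_rep, Projectivization.mk_rep] at hz'
    have hpos : ∀ k : ℙ F (Fin 3 → F), numOn (zeros Q) k = 0 → z ∉ k := fun k hk hzk => by
      have : z ∈ (zeros Q).filter (· ∈ k) := Finset.mem_filter.2 ⟨hz, hzk⟩
      rw [Finset.card_eq_zero.1 hk] at this
      simp at this
    exact hz'.elim (hpos l hl.2) (hpos m hm.2)

end Through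

end Curves

end BlowUpCode

namespace BlowUpCode

/-! ### Dimension of the space of forms through the cubic point -/

section Forms

open MvPolynomial Matrix

lemma finrank_homogeneousSubmodule (F : Type*) [Field F] (d : ℕ) :
    Module.finrank F (homogeneousSubmodule (Fin 3) F d) = (d + 2).choose 2 := by
  have hset : ({e | e.degree = d} : Set (Fin 3 →₀ ℕ)) =
      ((Finset.univ : Finset (Fin 3)).finsuppAntidiag d : Set (Fin 3 →₀ ℕ)) := by
    ext e
    simp [Finsupp.degree_eq_sum]
  rw [homogeneousSubmodule_eq_finsupp_supported, hset]
  rw [(AddMonoidAlgebra.supportedEquivFinsupp (R := F) (S := F) _).finrank_eq,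
    Module.finrank_finsupp_self, ← Nat.card_eq_fintype_card, Nat.card_coe_set_eq,
    Set.ncard_coe_finset, Finset.card_finsuppAntidiag_nat_eq_choose]
  rw [Finset.card_univ, Fintype.card_fin, show 3 + d - 1 = d + 2 by omega]
  exact Nat.choose_symm_of_eq_add rfl

section

variable {F K : Type*} [Field F] [Field K] [Algebra F K] {v : Fin 3 → K}

lemma OffLines.linearIndependent (hv : OffLines F v) : LinearIndependent F v := by
  rw [Fintype.linearIndependent_iff]
  intro g hg i
  by_contra hi
  refine hv g (fun h => hi (congrFun h i)) ?_
  rw [← hg]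
  simp [dotProduct, Algebra.smul_def]

/-- The forms of degree `d` which vanish at a given point. -/
noncomputable def formsThrough (F : Type*) {K : Type*} [Field F] [Field K] [Algebra F K]
    (v : Fin 3 → K) (d : ℕ) : Submodule F (MvPolynomial (Fin 3) F) :=
  homogeneousSubmodule (Fin 3) F d ⊓ LinearMap.ker (aeval v : _ →ₐ[F] K).toLinearMap

variable [Fintype F]

lemma aeval_pow_card (G : MvPolynomial (Fin 3) F) (w : Fin 3 → K) (n : ℕ) :
    aeval w G ^ Fintype.card F ^ n = aeval (fun i => w i ^ Fintype.card F ^ n) G := by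
  induction n with
  | zero => simp
  | succ n ih =>
    have h := (comp_aeval_apply (fun i => w i ^ Fintype.card F ^ n)
      (FiniteField.frobeniusAlgHom F K) G)
    rw [← ih] at h
    simp only [FiniteField.coe_frobeniusAlgHom, ← pow_mul, ← pow_succ] at h
    exact h

/-- The coordinates of `v` are independent over `F`, so their span has q³ elements. All are roots of
X^(q³) - X, which has no more roots than that: the span is the field of q³ elements. -/
lemma mem_span_of_pow_card_eq (hv : OffLines F v) (hv3 : ∀ i, v i ^ Fintype.card F ^ 3 = v i)
    {c : K} (hc : c ^ Fintype.card F ^ 3 = c) : c ∈ Submodule.span F (Set.range v) := by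
  classical
  set W := Submodule.span F (Set.range v)
  have hlin := hv.linearIndependent
  have hfin : Module.finrank F W = 3 := by
    rw [finrank_span_eq_card hlin, Fintype.card_fin]
  have hFW : Module.Finite F W := Module.finite_of_finrank_pos (by omega)
  have : Finite W := Module.finite_of_finite F
  have : Fintype W := Fintype.ofFinite W
  have hcard : Fintype.card W = Fintype.card F ^ 3 := by
    rw [Module.card_eq_pow_finrank (K := F), hfin]
  have hq : 1 < Fintype.card F ^ 3 := Nat.one_lt_pow (by omega) Fintype.one_lt_card
  set f : Polynomial K := Polynomial.X ^ Fintype.card F ^ 3 - Polynomial.X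
  have hf0 : f ≠ 0 := FiniteField.X_pow_card_sub_X_ne_zero K hq
  have hfd : f.natDegree = Fintype.card F ^ 3 := FiniteField.X_pow_card_sub_X_natDegree_eq K hq
  have hmem : ∀ x, x ∈ f.roots.toFinset ↔ x ^ Fintype.card F ^ 3 = x := fun x => by
    rw [Multiset.mem_toFinset, Polynomial.mem_roots hf0]
    simp [f, sub_eq_zero]
  have hW : ∀ x ∈ W, x ^ Fintype.card F ^ 3 = x := by
    intro x hx
    obtain ⟨g, rfl⟩ := (Submodule.mem_span_range_iff_exists_fun F).1 hx
    have h := aeval_pow_card (linForm g) v 3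
    simp only [hv3] at h
    rw [aeval_linForm] at h
    simpa [dotProduct, Algebra.smul_def] using h
  have hsub : (W : Set K).toFinset ⊆ f.roots.toFinset := by
    intro x hx
    rw [Set.mem_toFinset] at hx
    exact (hmem x).2 (hW x hx)
  have heq := Finset.eq_of_subset_of_card_le hsub (by
    rw [Set.toFinset_card]
    exact ((Multiset.toFinset_card_le _).trans (Polynomial.card_roots' _)).trans
      (hfd.trans hcard.symm).le)
  have := (hmem c).2 hc
  rw [← heq, Set.mem_toFinset] at this
  exact this

/-- The forms of degree `d` through a closed point of degree three have codimension three. -/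
lemma finrank_formsThrough (hv : OffLines F v) (hv3 : ∀ i, v i ^ Fintype.card F ^ 3 = v i)
    (hv0 : v 0 = 1) (d : ℕ) :
    Module.finrank F (formsThrough F v (d + 1)) + 3 = (d + 3).choose 2 := by
  set H := homogeneousSubmodule (Fin 3) F (d + 1)
  have hH : Module.finrank F H = (d + 3).choose 2 := finrank_homogeneousSubmodule F (d + 1)
  have hHfin : Module.Finite F H := Module.Finite.of_fg (homogeneousSubmodule_fg _ _ _)
  let φ : H →ₗ[F] K := (aeval v : _ →ₐ[F] K).toLinearMap.domRestrict H
  -- Values at `v` are fixed by the q³-power map, hence lie in the span. Conversely `X 0 ^ d * X i`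
  -- takes the value `v i`, because `v 0 = 1`.
  have hrange : LinearMap.range φ = Submodule.span F (Set.range v) := by
    apply le_antisymm
    · rintro _ ⟨G, rfl⟩
      apply mem_span_of_pow_card_eq hv hv3
      change aeval v G.1 ^ _ = aeval v G.1
      rw [aeval_pow_card]
      simp only [hv3]
    · rw [Submodule.span_le]
      rintro _ ⟨i, rfl⟩
      refine ⟨⟨X 0 ^ d * X i, ?_⟩, ?_⟩
      · exact (isHomogeneous_X_pow 0 d).mul (isHomogeneous_X F i)
      · change aeval v (X 0 ^ d * X i) = v i
        simp [hv0]
  have hker : formsThrough F v (d + 1) = (LinearMap.ker φ).map H.subtype := by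
    ext G
    constructor
    · rintro ⟨h1, h2⟩
      exact ⟨⟨G, h1⟩, h2, rfl⟩
    · rintro ⟨G, h, rfl⟩
      exact ⟨G.2, h⟩
  have := LinearMap.finrank_range_add_finrank_ker φ
  rw [hrange, finrank_span_eq_card hv.linearIndependent, Fintype.card_fin, hH] at this
  rw [hker, Submodule.finrank_map_subtype_eq]
  omega

/-- Passing through `a` and `b` imposes two linear conditions on a space of dimension 6 - 3 = 3. -/
lemma exists_conic (hv : OffLines F v) (hv3 : ∀ i, v i ^ Fintype.card F ^ 3 = v i)
    (hv0 : v 0 = 1) (a b : Fin 3 → F) :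
    ∃ Q : MvPolynomial (Fin 3) F, Q.IsHomogeneous 2 ∧ Q ≠ 0 ∧ aeval v Q = 0 ∧
      eval a Q = 0 ∧ eval b Q = 0 := by
  have h : Module.finrank F (formsThrough F v 2) + 3 = 6 := finrank_formsThrough hv hv3 hv0 1
  have h3 : Module.finrank F (formsThrough F v 2) = 3 := by omega
  have hfin : Module.Finite F (formsThrough F v 2) := Module.finite_of_finrank_pos (by omega)
  let φ : formsThrough F v 2 →ₗ[F] F × F :=
    ((aeval a : _ →ₐ[F] F).toLinearMap.prod (aeval b : _ →ₐ[F] F).toLinearMap).domRestrict _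
  have hφ : LinearMap.ker φ ≠ ⊥ := LinearMap.ker_ne_bot_of_finrank_lt (by simp [h3])
  obtain ⟨Q, hQ, hQ0⟩ := Submodule.exists_mem_ne_zero_of_ne_bot hφ
  have hQ : (aeval a Q.1, aeval b Q.1) = ((0, 0) : F × F) := hQ
  rw [Prod.mk.injEq] at hQ
  exact ⟨Q.1, Q.2.1, by simpa using hQ0, Q.2.2, hQ.1, hQ.2⟩

end

end Forms

/-! ### Normalized coordinates of the cubic point -/

namespace CubicPoint

open MvPolynomial Matrix

section

variable {F K : Type*} [Field F] [Field K] [Algebra F K]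

lemma algebraMap_vec_ne_zero {l : Fin 3 → F} (hl : l ≠ 0) :
    (fun i => algebraMap F K (l i)) ≠ 0 := by
  obtain ⟨i, hi⟩ := Function.ne_iff.1 hl
  exact fun h => hi ((map_eq_zero _).1 (congrFun h i))

variable [Fintype F]

lemma frobVec_apply_eq (w : Fin 3 → K) (j : Fin 3) : frobVec F K w j = w j ^ Fintype.card F := rfl

lemma iterate_frobVec (n : ℕ) (w : Fin 3 → K) (j : Fin 3) :
    ((frobVec F K)^[n] w) j = w j ^ Fintype.card F ^ n := by
  induction n generalizing w with
  | zero => simp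
  | succ n ih =>
    rw [Function.iterate_succ_apply, ih, frobVec_apply_eq, ← pow_mul]
    congr 1
    ring

lemma iterate_frobVec_ne_zero {w : Fin 3 → K} (hw : w ≠ 0) (n : ℕ) : (frobVec F K)^[n] w ≠ 0 := by
  induction n generalizing w with
  | zero => exact hw
  | succ n ih => exact ih (frobVec_ne_zero F K hw)

lemma iterate_frob_mk {w : Fin 3 → K} (hw : w ≠ 0) (n : ℕ) :
    (frob F K)^[n] (Projectivization.mk K w hw) =
      Projectivization.mk K _ (iterate_frobVec_ne_zero (F := F) hw n) := by
  induction n generalizing w with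
  | zero => rfl
  | succ n ih =>
    rw [Function.iterate_succ_apply, frob, Projectivization.map_mk]
    exact ih (frobVec_ne_zero F K hw)

lemma frobVec_algebraMap (l : Fin 3 → F) :
    frobVec F K (fun i => algebraMap F K (l i)) = fun i => algebraMap F K (l i) := by
  ext i
  rw [frobVec_apply_eq, ← map_pow, FiniteField.pow_card]

variable (P : CubicPoint F K)

/-- A normalized vector which represents one of the three geometric points. -/
lemma exists_vec : ∃ (v : Fin 3 → K) (hv : v ≠ 0), P.pt = Projectivization.mk K v hv ∧ v 0 = 1 ∧
    OffLines F v ∧ ∀ i, v i ^ Fintype.card F ^ 3 = v i := by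
  obtain ⟨w, hw, hP⟩ : ∃ (w : Fin 3 → K) (hw : w ≠ 0), P.pt = Projectivization.mk K w hw :=
    ⟨P.pt.rep, P.pt.rep_nonzero, (Projectivization.mk_rep _).symm⟩
  have hoff : OffLines F w := by
    intro l hl h0
    refine P.notMem_line (Projectivization.mk K _ (algebraMap_vec_ne_zero (K := K) hl)) ?_ ?_
    · rw [frob, Projectivization.map_mk]
      simp only [frobVec_algebraMap]
    · rw [hP, Projectivization.orthogonal_mk, dotProduct_comm, h0]
  -- The line X₀ = 0 is rational.
  have hw0 : w 0 ≠ 0 := by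
    have := hoff (Pi.single 0 1) (by simp)
    simpa [dotProduct, Fin.sum_univ_three] using this
  have hne : (w 0)⁻¹ • w ≠ 0 := smul_ne_zero (inv_ne_zero hw0) hw
  have hP' : P.pt = Projectivization.mk K _ hne := by
    rw [hP, Projectivization.mk_eq_mk_iff']
    exact ⟨w 0, by rw [smul_smul, mul_inv_cancel₀ hw0, one_smul]⟩
  have hone : ((w 0)⁻¹ • w) 0 = 1 := by simp [hw0]
  refine ⟨_, hne, hP', hone, fun l hl h0 => hoff l hl ?_, ?_⟩
  · rw [dotProduct_smul, smul_eq_mul] at h0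
    exact (mul_eq_zero.1 h0).resolve_left (inv_ne_zero hw0)
  · have hper : (frob F K)^[3] P.pt = P.pt := by
      have := Function.iterate_minimalPeriod (f := frob F K) (x := P.pt)
      rwa [P.degree_eq] at this
    rw [hP', iterate_frob_mk, Projectivization.mk_eq_mk_iff'] at hper
    -- Period three holds only up to a scalar `c`; the normalized coordinate 0 forces `c = 1`.
    obtain ⟨c, hc⟩ := hper
    have hc0 := congrFun hc 0
    rw [iterate_frobVec, Pi.smul_apply, hone, one_pow, smul_eq_mul, mul_one] at hc0
    intro i
    have := congrFun hc i
    rw [iterate_frobVec, hc0, one_smul] at this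
    exact this.symm

lemma conj_ne {i j : Fin 3} (h : i ≠ j) : P.conj i ≠ P.conj j := by
  intro he
  apply h
  ext
  exact (Function.iterate_injOn_Iio_minimalPeriod (f := frob F K) (x := P.pt))
    (by rw [P.degree_eq]; exact i.2) (by rw [P.degree_eq]; exact j.2) he

end

end CubicPoint

end BlowUpCode

namespace BlowUpCode

/-! ### Extension of functions across three lines through the origin -/

section Hartogs

open MvPolynomial Matrix

variable {K : Type*} [Field K]

/-- A polynomial which vanishes off finitely many planes is zero. -/
lemma eq_zero_of_eval_off_planes [Infinite K] {m : Fin 3 → Fin 3 → K} (hm : ∀ i, m i ≠ 0)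
    {H : MvPolynomial (Fin 3) K} (h : ∀ v, (∀ i, v ⬝ᵥ m i ≠ 0) → eval v H = 0) : H = 0 := by
  have hprod : H * ∏ i, linForm (m i) = 0 := by
    refine MvPolynomial.funext fun v => ?_
    rw [map_mul, map_zero, map_prod]
    by_cases hv : ∀ i, v ⬝ᵥ m i ≠ 0
    · rw [h v hv, zero_mul]
    · push Not at hv
      obtain ⟨i, hi⟩ := hv
      rw [Finset.prod_eq_zero (Finset.mem_univ i) (by rw [eval_linForm, hi]), mul_zero]
  exact (mul_eq_zero.1 hprod).resolve_right
    (Finset.prod_ne_zero_iff.2 fun i _ => linForm_ne_zero (hm i))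

/-- The vectors which are not proportional to one of three given vectors. -/
def Off (c : Fin 3 → Fin 3 → K) (v : Fin 3 → K) : Prop := ∀ i, v ⨯₃ c i ≠ 0

variable {c : Fin 3 → Fin 3 → K}

lemma exists_ne_zero_dotProduct_eq_zero {p : Fin 3 → K} (hp : p ≠ 0) :
    ∃ m, m ≠ 0 ∧ p ⬝ᵥ m = 0 := by
  by_cases h : p ⨯₃ Pi.single 0 1 = 0
  · refine ⟨p ⨯₃ Pi.single 1 1, fun h' => hp ?_, dot_self_cross _ _⟩
    have h1 := congrFun h 1
    have h2 := congrFun h 2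
    have h3 := congrFun h' 2
    simp [cross_apply] at h1 h2 h3
    ext i
    fin_cases i <;> simp [h1, h2, h3]
  · exact ⟨_, h, dot_self_cross _ _⟩

lemma eq_smul_of_cross_eq_zero {v p : Fin 3 → K} (hp : p ≠ 0) (h : v ⨯₃ p = 0) :
    ∃ a : K, v = a • p := by
  obtain ⟨k, hk⟩ := Function.ne_iff.1 hp
  have hk : p k ≠ 0 := hk
  have h0 := congrFun h 0
  have h1 := congrFun h 1
  have h2 := congrFun h 2
  simp only [cross_apply, cons_val_zero, cons_val_one, cons_val, Pi.zero_apply] at h0 h1 h2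
  refine ⟨v k / p k, funext fun i => ?_⟩
  rw [Pi.smul_apply, smul_eq_mul, div_mul_eq_mul_div, eq_div_iff hk]
  fin_cases k <;> fin_cases i <;> simp <;>
    first | linear_combination h0 | linear_combination h1 | linear_combination h2 |
      linear_combination -h0 | linear_combination -h1 | linear_combination -h2

lemma eq_zero_of_eval_off [Infinite K] (hc : ∀ i, c i ≠ 0) {H : MvPolynomial (Fin 3) K}
    (h : ∀ v, Off c v → eval v H = 0) : H = 0 := by
  choose m hm hcm using fun i => exists_ne_zero_dotProduct_eq_zero (hc i)
  refine eq_zero_of_eval_off_planes hm fun v hv => h v fun i h0 => hv i ?_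
  obtain ⟨a, rfl⟩ := eq_smul_of_cross_eq_zero (hc i) h0
  rw [smul_dotProduct, hcm, smul_zero]

lemma exists_off [Infinite K] (hc : ∀ i, c i ≠ 0) : ∃ v, Off c v := by
  by_contra! h
  exact one_ne_zero (eq_zero_of_eval_off hc (H := 1) fun v hv => absurd hv (h v))

/-- A polynomial without zeros off three lines through the origin is constant. -/
lemma eq_C_of_eval_ne_zero [IsAlgClosed K] (hc : ∀ i, c i ≠ 0) {B : MvPolynomial (Fin 3) K}
    (h : ∀ v, Off c v → eval v B ≠ 0) : ∃ k : K, k ≠ 0 ∧ B = C k := by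
  have : Infinite K := IsAlgClosed.instInfinite
  obtain ⟨v, hv⟩ := exists_off hc
  -- For `u` outside the planes spanned by `v` and the `c i`, the line `v + t u` avoids the three
  -- removed lines. There `B` has no root, so it is constant along that line.
  have key : ∀ u, (∀ i, u ⬝ᵥ v ⨯₃ c i ≠ 0) → eval (v + u) B = eval v B := by
    intro u hu
    have hoff : ∀ t : K, Off c (v + t • u) := by
      intro t i h0
      apply hu i
      have h1 : u ⬝ᵥ (v + t • u) ⨯₃ c i = u ⬝ᵥ v ⨯₃ c i := by
        rw [map_add, map_smul, LinearMap.add_apply, LinearMap.smul_apply, dotProduct_add,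
          dotProduct_smul, dot_self_cross, smul_zero, add_zero]
      rw [← h1, h0, dotProduct_zero]
    have hdeg : (restr v u B).degree = 0 := by
      by_contra hne
      obtain ⟨t, ht⟩ := IsAlgClosed.exists_root _ hne
      rw [Polynomial.IsRoot.def, eval_restr] at ht
      exact h _ (hoff t) ht
    have h0 := eval_restr v u 0 B
    have h1 := eval_restr v u 1 B
    rw [Polynomial.eq_C_of_degree_eq_zero hdeg, Polynomial.eval_C] at h0 h1
    rw [one_smul] at h1
    rw [zero_smul, add_zero] at h0
    rw [← h1, h0]
  refine ⟨eval v B, h v hv, ?_⟩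
  have hH : aeval (fun i => X i + C (v i)) B - C (eval v B) = 0 := by
    refine eq_zero_of_eval_off_planes (m := fun i => v ⨯₃ c i) hv fun u hu => ?_
    rw [map_sub, eval_C, ← key u hu, ← aeval_eq_eval, ← aeval_eq_eval, comp_aeval_apply, sub_eq_zero]
    congr 2
    ext i
    simp [add_comm]
  refine MvPolynomial.funext fun w => ?_
  have h2 := congrArg (eval (w - v)) hH
  rw [map_sub, eval_C, map_zero, sub_eq_zero, ← aeval_eq_eval, comp_aeval_apply] at h2
  rw [eval_C, ← h2, ← aeval_eq_eval]
  congr 2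
  ext i
  simp

/-- A function which is locally a quotient of polynomials off three lines through the origin is a
polynomial. -/
lemma exists_polynomial_of_locally_quotient [IsAlgClosed K] (hc : ∀ i, c i ≠ 0)
    {S : (Fin 3 → K) → K}
    (hS : ∀ v, Off c v → ∃ A B : MvPolynomial (Fin 3) K, eval v B ≠ 0 ∧
      ∀ w, Off c w → eval w B ≠ 0 → S w = eval w A / eval w B) :
    ∃ G : MvPolynomial (Fin 3) K, ∀ v, Off c v → S v = eval v G := by
  have : Infinite K := IsAlgClosed.instInfinite
  obtain ⟨v₀, hv₀⟩ := exists_off hc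
  obtain ⟨A₀, B₀, hB₀, h₀⟩ := hS v₀ hv₀
  have hB₀' : B₀ ≠ 0 := by rintro rfl; simp at hB₀
  -- Write A₀/B₀ = a/b in lowest terms. Any local representation A/B satisfies aB = Ab, so b divides
  -- B. Hence b has no zero off the three lines and is constant.
  obtain ⟨b, a, e, hrel, hb, ha⟩ := UniqueFactorizationMonoid.exists_reduced_factors B₀ hB₀' A₀
  have hcross : ∀ v A B, eval v B ≠ 0 → (∀ w, Off c w → eval w B ≠ 0 →
      S w = eval w A / eval w B) → a * B = A * b := by
    intro v A B hB h
    have hB' : B ≠ 0 := by rintro rfl; simp at hB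
    have h1 : (A₀ * B - A * B₀) * (B₀ * B) = 0 := by
      refine eq_zero_of_eval_off hc fun w hw => ?_
      by_cases h2 : eval w B₀ = 0
      · simp [h2]
      by_cases h3 : eval w B = 0
      · simp [h3]
      have h4 := (h₀ w hw h2).symm.trans (h w hw h3)
      rw [div_eq_div_iff h2 h3] at h4
      simp [h4]
    have h2 := sub_eq_zero.1 ((mul_eq_zero.1 h1).resolve_right (mul_ne_zero hB₀' hB'))
    have he : e ≠ 0 := by rintro rfl; simp at hb; exact hB₀' hb.symm
    apply mul_left_cancel₀ he
    rw [← mul_assoc, ha, h2, ← hb]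
    ring
  have hbv : ∀ v, Off c v → eval v b ≠ 0 := by
    intro v hv
    obtain ⟨A, B, hB, h⟩ := hS v hv
    have h1 : b ∣ a * B := ⟨A, by rw [hcross v A B hB h, mul_comm]⟩
    obtain ⟨f, rfl⟩ := hrel.dvd_of_dvd_mul_left h1
    rw [map_mul] at hB
    exact left_ne_zero_of_mul hB
  obtain ⟨k, hk, rfl⟩ := eq_C_of_eval_ne_zero hc hbv
  refine ⟨C k⁻¹ * a, fun v hv => ?_⟩
  obtain ⟨A, B, hB, h⟩ := hS v hv
  have h1 := congrArg (eval v) (hcross v A B hB h)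
  rw [map_mul, map_mul, eval_C] at h1
  rw [h v hv hB, map_mul, eval_C, div_eq_iff hB, mul_assoc, h1]
  field_simp

end Hartogs

end BlowUpCode

namespace BlowUpCode

namespace CubicPoint

open MvPolynomial Matrix

/-! ### Regular sections over `K` as forms -/

section Sections

variable {F K : Type*} [Field F] [Fintype F] [Field K] [Algebra F K] {P : CubicPoint F K}

variable (P) in
/-- Vectors which represent the three geometric points. -/
noncomputable def conjVec (i : Fin 3) : Fin 3 → K := (P.conj i).rep

lemma conjVec_ne_zero (i : Fin 3) : P.conjVec i ≠ 0 := Projectivization.rep_nonzero _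

lemma mk_conjVec (i : Fin 3) : Projectivization.mk K _ (P.conjVec_ne_zero i) = P.conj i :=
  Projectivization.mk_rep _

lemma cross_conjVec_eq_zero_iff {v : Fin 3 → K} (hv : v ≠ 0) (i : Fin 3) :
    v ⨯₃ P.conjVec i = 0 ↔ Projectivization.mk K v hv = P.conj i := by
  rw [← mk_conjVec, Projectivization.mk_eq_mk_iff_crossProduct_eq_zero]

lemma conjVec_cross_ne_zero {i j : Fin 3} (h : i ≠ j) : P.conjVec i ⨯₃ P.conjVec j ≠ 0 := by
  rw [ne_eq, cross_conjVec_eq_zero_iff (conjVec_ne_zero i), mk_conjVec]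
  exact P.conj_ne h

lemma ne_zero_of_off {v : Fin 3 → K} (h : Off P.conjVec v) : v ≠ 0 := by
  rintro rfl
  exact h 0 (by simp)

/-- Coordinates of the point of `Z` over a point of the plane away from the centres. -/
noncomputable def offCoords {v : Fin 3 → K} (h : Off P.conjVec v) : P.Coords where
  vec := v
  line i := v ⨯₃ P.conjVec i
  vec_ne := ne_zero_of_off h
  line_ne := h
  mem_line i := by rw [Projectivization.orthogonal_mk, dot_self_cross]
  conj_mem_line i := by
    rw [← mk_conjVec, Projectivization.orthogonal_mk, dot_cross_self]

lemma mk_line_eq {v p l : Fin 3 → K} (h : v ⨯₃ p ≠ 0) (hl : l ≠ 0) (hv : v ⬝ᵥ l = 0)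
    (hp : p ⬝ᵥ l = 0) : Projectivization.mk K l hl = Projectivization.mk K _ h := by
  rw [Projectivization.mk_eq_mk_iff_crossProduct_eq_zero]
  simp only [vec3_dotProduct] at hv hp
  ext i
  fin_cases i <;> simp [cross_apply]
  · linear_combination v 0 * hp - p 0 * hv
  · linear_combination v 1 * hp - p 1 * hv
  · linear_combination v 2 * hp - p 2 * hv

lemma toZ_offCoords (w : P.Coords) (h : Off P.conjVec w.vec) : w.toZ = (offCoords h).toZ := by
  simp only [Coords.toZ, offCoords, Z.mk.injEq, true_and]
  ext1 i
  have h1 := w.mem_line i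
  have h2 := w.conj_mem_line i
  rw [Projectivization.orthogonal_mk] at h1
  rw [← mk_conjVec, Projectivization.orthogonal_mk] at h2
  exact mk_line_eq (h i) (w.line_ne i) h1 h2

/-- The multihomogeneous coordinates of a variable point of the plane. -/
noncomputable def pullVar (c : Fin 3 → Fin 3 → K) : Fin 3 ⊕ Fin 3 × Fin 3 → MvPolynomial (Fin 3) K :=
  Sum.elim X fun ij => ((X : Fin 3 → MvPolynomial (Fin 3) K) ⨯₃ fun k => C (c ij.1 k)) ij.2

lemma eval_aeval_pullVar (c : Fin 3 → Fin 3 → K) (v : Fin 3 → K)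
    (A : MvPolynomial (Fin 3 ⊕ Fin 3 × Fin 3) K) :
    eval v (aeval (pullVar c) A) =
      eval (Sum.elim v fun ij => (v ⨯₃ c ij.1) ij.2) A := by
  rw [← aeval_eq_eval, ← aeval_eq_eval, comp_aeval_apply]
  congr 2
  ext s
  rcases s with s | ⟨i, j⟩
  · simp [pullVar]
  · fin_cases j <;> simp [pullVar, cross_apply]

lemma eval_pull_offCoords {v : Fin 3 → K} (h : Off P.conjVec v)
    (A : MvPolynomial (Fin 3 ⊕ Fin 3 × Fin 3) K) :
    (offCoords h).eval A = eval v (aeval (pullVar P.conjVec) A) :=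
  (eval_aeval_pullVar _ _ _).symm

lemma pullVar_isHomogeneous (c : Fin 3 → Fin 3 → K) (s : Fin 3 ⊕ Fin 3 × Fin 3) :
    (pullVar c s).IsHomogeneous 1 := by
  rcases s with s | ⟨i, j⟩
  · exact isHomogeneous_X _ _
  · have h : ∀ k (a : K), (X k * C a : MvPolynomial (Fin 3) K).IsHomogeneous 1 := fun k a => by
      rw [mul_comm]; exact isHomogeneous_C_mul_X a k
    fin_cases j <;> simp only [pullVar, cross_apply, Sum.elim_inr] <;> exact (h _ _).sub (h _ _)

/-- The coordinates `v ⨯₃ c i` of the i-th line are linear in `v`, so every multidegree component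
adds to the total degree. -/
lemma pull_isHomogeneous (c : Fin 3 → Fin 3 → K) {A : MvPolynomial (Fin 3 ⊕ Fin 3 × Fin 3) K}
    {a : ℕ} {b : Fin 3 → ℕ} (hA : A.IsWeightedHomogeneous multidegree (a, b)) :
    (aeval (pullVar c) A).IsHomogeneous (a + ∑ i, b i) := by
  rw [aeval_def, eval₂_eq']
  refine IsHomogeneous.sum _ _ _ fun e he => ?_
  have hw := hA (mem_support_iff.1 he)
  rw [Finsupp.weight_apply, Finsupp.sum_fintype _ _ (by simp)] at hw
  have h1 := congrArg Prod.fst hw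
  have h2 := fun i => congrFun (congrArg Prod.snd hw) i
  have hdeg : ∑ s, e s = a + ∑ i, b i := by
    simp only [multidegree, Fintype.sum_sum_type, Fintype.sum_prod_type, Prod.fst_add,
      Prod.fst_sum] at h1
    have h1' : ∑ x, e (Sum.inl x) = a := by simpa using h1
    have h2' : ∀ i, ∑ j, e (Sum.inr (i, j)) = b i := fun i => by
      simpa [multidegree, Fintype.sum_prod_type, Prod.snd_sum, Finset.sum_apply, Pi.single_apply]
        using h2 i
    rw [Fintype.sum_sum_type, h1', Fintype.sum_prod_type]
    simp only [h2']
  rw [← hdeg, ← zero_add (∑ s, e s), MvPolynomial.algebraMap_eq]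
  refine (isHomogeneous_C _ _).mul (IsHomogeneous.prod _ _ _ fun s _ => ?_)
  simpa using (pullVar_isHomogeneous c s).pow (e s)

/-- Away from the exceptional divisor, a regular section is given by a form. -/
lemma exists_form_of_isRegularSection [IsAlgClosed K] {d : ℕ} {s : P.Coords → K}
    (hs : IsRegularSection d s) : ∃ G : MvPolynomial (Fin 3) K, G.IsHomogeneous d ∧
      ∀ w : P.Coords, Off P.conjVec w.vec → s w = eval w.vec G := by
  classical
  have : Infinite K := IsAlgClosed.instInfinite
  obtain ⟨G, hG⟩ := exists_polynomial_of_locally_quotient (c := P.conjVec) conjVec_ne_zero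
    (S := fun v => if h : Off P.conjVec v then s (offCoords h) else 0) (fun v hv => by
      obtain ⟨A, B, a, b, -, -, hB0, h⟩ := hs (offCoords hv)
      refine ⟨aeval (pullVar P.conjVec) A, aeval (pullVar P.conjVec) B, ?_, fun w hw hwB => ?_⟩
      · rwa [← eval_pull_offCoords hv]
      · rw [← eval_pull_offCoords hw] at hwB
        rw [dif_pos hw, ← eval_pull_offCoords hw, ← eval_pull_offCoords hw]
        exact h _ hwB)
  have hG' : ∀ v (hv : Off P.conjVec v), s (offCoords hv) = eval v G := fun v hv => by
    rw [← hG v hv, dif_pos hv]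
  refine ⟨G, ?_, fun w hw => ?_⟩
  · obtain ⟨v, hv⟩ := exists_off (c := P.conjVec) conjVec_ne_zero
    obtain ⟨A, B, a, b, hA, hB, hB0, h⟩ := hs (offCoords hv)
    rw [eval_pull_offCoords] at hB0
    set A' := aeval (pullVar P.conjVec) A
    set B' := aeval (pullVar P.conjVec) B
    have hB' : B' ≠ 0 := by intro h0; simp [h0] at hB0
    -- The relation A' = G B' holds off the zeros of B' and the three lines, hence identically.
    -- Comparing degrees then shows that `G` is homogeneous of degree `d`.
    have hmul : (A' - G * B') * B' = 0 := by
      refine eq_zero_of_eval_off (c := P.conjVec) conjVec_ne_zero fun w hw => ?_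
      by_cases hw0 : eval w B' = 0
      · simp [hw0]
      · have h1 := h (offCoords hw) (by rwa [eval_pull_offCoords])
        rw [hG', eval_pull_offCoords, eval_pull_offCoords, eq_div_iff hw0] at h1
        rw [map_mul, map_sub, map_mul, h1, sub_self, zero_mul]
    have heq := sub_eq_zero.1 ((mul_eq_zero.1 hmul).resolve_right hB')
    refine isHomogeneous_of_mul (pull_isHomogeneous _ hB) hB' ?_
    change (G * B').IsHomogeneous _
    rw [← heq]
    convert pull_isHomogeneous P.conjVec hA using 1
    ring
  · rw [← hG' _ hw]
    exact hs.congr (toZ_offCoords w hw) rfl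

/-- If a regular section vanishes on the exceptional divisor, the form vanishes at the centres. -/
lemma eval_conjVec_eq_zero [IsAlgClosed K] {d : ℕ} {s : P.Coords → K}
    (hs : IsRegularSection d s) (hs0 : ∀ w, w.toZ ∈ Z.exceptional P → s w = 0)
    {G : MvPolynomial (Fin 3) K} (hG : ∀ w : P.Coords, Off P.conjVec w.vec → s w = eval w.vec G)
    (i : Fin 3) : eval (P.conjVec i) G = 0 := by
  classical
  have : Infinite K := IsAlgClosed.instInfinite
  obtain ⟨m, hm, hmi⟩ := exists_ne_zero_dotProduct_eq_zero (conjVec_ne_zero (P := P) i)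
  obtain ⟨u, hu⟩ := exists_cross_eq (conjVec_ne_zero i) hmi
  -- The arc `t ↦ p_i + t u` lifts to `Z` with constant i-th line `m`. At `t = 0` the lift lies on
  -- `E`, where `s` vanishes; the relation between `s` and `G`, known for most `t ≠ 0`, is carried
  -- over to `t = 0` as an identity of polynomials in `t`.
  let vec : K → Fin 3 → K := fun t => P.conjVec i + t • u
  let line : K → Fin 3 → Fin 3 → K := fun t j => if j = i then m else vec t ⨯₃ P.conjVec j
  have hmem : ∀ t j, vec t ⬝ᵥ line t j = 0 := fun t j => by
    by_cases hj : j = i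
    · simp only [line, if_pos hj, vec]
      rw [← hu, add_dotProduct, smul_dotProduct, dot_self_cross, dot_cross_self, smul_zero, add_zero]
    · simp only [line, if_neg hj, dot_self_cross]
  have hcmem : ∀ t j, P.conjVec j ⬝ᵥ line t j = 0 := fun t j => by
    by_cases hj : j = i
    · subst hj
      simp only [line, if_true, hmi]
    · simp only [line, if_neg hj, dot_cross_self]
  have hvec : ∀ t, (∀ j, line t j ≠ 0) → vec t ≠ 0 := fun t ht h0 => by
    have hne : i + 1 ≠ i := by fin_cases i <;> decide
    apply ht (i + 1)
    simp [line, hne, h0]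
  let coords : ∀ t, (∀ j, line t j ≠ 0) → P.Coords := fun t ht =>
    { vec := vec t
      line := line t
      vec_ne := hvec t ht
      line_ne := ht
      mem_line := fun j => by rw [Projectivization.orthogonal_mk, hmem]
      conj_mem_line := fun j => by
        rw [← mk_conjVec, Projectivization.orthogonal_mk, hcmem] }
  have h0 : ∀ j, line 0 j ≠ 0 := fun j => by
    by_cases hj : j = i
    · simpa only [line, if_pos hj] using hm
    · simp only [line, if_neg hj, vec, zero_smul, add_zero]
      exact conjVec_cross_ne_zero (Ne.symm hj)
  have hzero : s (coords 0 h0) = 0 := by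
    refine hs0 _ ⟨i, ?_⟩
    rw [← mk_conjVec]
    simp only [Coords.toZ, coords, vec, zero_smul, add_zero]
  obtain ⟨A, B, a, b, -, -, hB0, h⟩ := hs (coords 0 h0)
  -- the coordinates along the curve, as polynomials in the parameter
  let pvec : Fin 3 → Polynomial K := fun k =>
    Polynomial.C (P.conjVec i k) + Polynomial.X * Polynomial.C (u k)
  let pline : Fin 3 → Fin 3 → Polynomial K := fun j => if j = i then fun k => Polynomial.C (m k)
    else pvec ⨯₃ fun k => Polynomial.C (P.conjVec j k)
  have evvec : ∀ t k, (pvec k).eval t = vec t k := fun t k => by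
    simp only [pvec, vec, Polynomial.eval_add, Polynomial.eval_mul, Polynomial.eval_C,
      Polynomial.eval_X, Pi.add_apply, Pi.smul_apply, smul_eq_mul]
  have evline : ∀ t j k, (pline j k).eval t = line t j k := fun t j k => by
    by_cases hj : j = i
    · simp [pline, line, hj]
    · simp only [pline, line, if_neg hj]
      fin_cases k <;> simp [cross_apply, evvec]
  let pull : MvPolynomial (Fin 3 ⊕ Fin 3 × Fin 3) K → Polynomial K :=
    aeval (Sum.elim pvec fun jk => pline jk.1 jk.2)
  have evpull : ∀ t D, (pull D).eval t = eval (Sum.elim (vec t) fun jk => line t jk.1 jk.2) D := by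
    intro t D
    rw [← Polynomial.coe_aeval_eq_eval, ← aeval_eq_eval]
    simp only [pull]
    rw [comp_aeval_apply]
    congr 2
    ext x
    rcases x with x | ⟨j, k⟩
    · simp [evvec]
    · simp [evline]
  let pG : Polynomial K := aeval pvec G
  have evG : ∀ t, pG.eval t = eval (vec t) G := fun t => by
    rw [← Polynomial.coe_aeval_eq_eval, ← aeval_eq_eval]
    simp only [pG]
    rw [comp_aeval_apply]
    congr 2
    ext x
    simp [evvec]
  have hk : ∀ j, ∃ k, line 0 j k ≠ 0 := fun j => Function.ne_iff.1 (h0 j)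
  choose k hk using hk
  -- The extra factors vanish at the parameters where the lift may be undefined, lies on `E`, or
  -- makes the denominator zero.
  have hprod : (pull A - pG * pull B) * (pull B * Polynomial.X * ∏ j, pline j (k j)) = 0 := by
    refine Polynomial.funext fun t => ?_
    simp only [Polynomial.eval_mul, Polynomial.eval_sub, Polynomial.eval_X, Polynomial.eval_zero,
      Polynomial.eval_prod, evline]
    by_cases ht : t = 0
    · simp [ht]
    by_cases hl : ∀ j, line t j (k j) ≠ 0
    · have hl' : ∀ j, line t j ≠ 0 := fun j h0 => hl j (congrFun h0 _)
      by_cases hB : (pull B).eval t = 0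
      · simp [hB]
      · have hBe : (coords t hl').eval B ≠ 0 := by
          rw [evpull] at hB
          exact hB
        have hoff : Off P.conjVec (coords t hl').vec := fun j => by
          by_cases hj : j = i
          · subst hj
            change (P.conjVec j + t • u) ⨯₃ P.conjVec j ≠ 0
            rw [map_add, map_smul, LinearMap.add_apply, LinearMap.smul_apply, cross_self, zero_add,
              ← cross_anticomm, hu]
            exact smul_ne_zero ht (neg_ne_zero.2 hm)
          · have := hl' j
            simp only [line, if_neg hj] at this
            exact this
        have h1 := h _ hBe
        rw [hG _ hoff, eq_div_iff hBe] at h1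
        have h2 : (pull A).eval t = (coords t hl').eval A := evpull t A
        have h3 : (pull B).eval t = (coords t hl').eval B := evpull t B
        have h4 : pG.eval t = eval (coords t hl').vec G := evG t
        rw [h2, h3, h4, h1, sub_self, zero_mul]
    · push Not at hl
      obtain ⟨j, hj⟩ := hl
      rw [Finset.prod_eq_zero (Finset.mem_univ j) hj]
      simp
  have hB0' : (pull B).eval 0 ≠ 0 := by
    rw [evpull]
    exact hB0
  have hne : pull B * Polynomial.X * ∏ j, pline j (k j) ≠ 0 := by
    refine mul_ne_zero (mul_ne_zero ?_ Polynomial.X_ne_zero)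
      (Finset.prod_ne_zero_iff.2 fun j _ hj => ?_)
    · intro h1
      simp [h1] at hB0'
    · apply hk j
      rw [← evline, hj, Polynomial.eval_zero]
  have heq := congrArg (Polynomial.eval 0)
    (sub_eq_zero.1 ((mul_eq_zero.1 hprod).resolve_right hne))
  rw [Polynomial.eval_mul, evG] at heq
  have hA0 : (pull A).eval 0 = 0 := by
    have h1 := h _ hB0
    rw [hzero, eq_comm, div_eq_zero_iff] at h1
    rw [evpull]
    exact h1.resolve_right hB0
  rw [hA0] at heq
  have h5 := (mul_eq_zero.1 heq.symm).resolve_right hB0'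
  simpa [vec] using h5

end Sections

end CubicPoint

end BlowUpCode

namespace BlowUpCode

open MvPolynomial Matrix

lemma mem_range_of_pow_card_eq {F K : Type*} [Field F] [Fintype F] [Field K] [Algebra F K] {c : K}
    (h : c ^ Fintype.card F = c) : c ∈ Set.range (algebraMap F K) := by
  classical
  have hq : 1 < Fintype.card F := Fintype.one_lt_card
  set f : Polynomial K := Polynomial.X ^ Fintype.card F - Polynomial.X
  have hf0 : f ≠ 0 := FiniteField.X_pow_card_sub_X_ne_zero K hq
  have hfd : f.natDegree = Fintype.card F := FiniteField.X_pow_card_sub_X_natDegree_eq K hq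
  have hmem : ∀ x, x ∈ f.roots.toFinset ↔ x ^ Fintype.card F = x := fun x => by
    rw [Multiset.mem_toFinset, Polynomial.mem_roots hf0]
    simp [f, sub_eq_zero]
  have hsub : Finset.univ.image (algebraMap F K) ⊆ f.roots.toFinset := by
    intro x hx
    obtain ⟨a, -, rfl⟩ := Finset.mem_image.1 hx
    rw [hmem, ← map_pow, FiniteField.pow_card]
  have heq := Finset.eq_of_subset_of_card_le hsub (by
    rw [Finset.card_image_of_injective _ (algebraMap F K).injective, Finset.card_univ]
    exact ((Multiset.toFinset_card_le _).trans (Polynomial.card_roots' _)).trans hfd.le)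
  have := (hmem c).2 h
  rw [← heq, Finset.mem_image] at this
  obtain ⟨a, -, ha⟩ := this
  exact ⟨a, ha⟩

/-! ### Descent of sections to `F` -/

namespace CubicPoint

variable {F K : Type*} [Field F] [Fintype F] [Field K] [Algebra F K] {P : CubicPoint F K}

/-- Frobenius permutes the three centres. -/
lemma frobVec_off_iff {v : Fin 3 → K} : Off P.conjVec (frobVec F K v) ↔ Off P.conjVec v := by
  by_cases hv : v = 0
  · subst hv
    rw [map_zero]
  have hmk : Projectivization.mk K _ (frobVec_ne_zero F K hv) =
      frob F K (Projectivization.mk K v hv) := rfl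
  simp only [Off, ne_eq, cross_conjVec_eq_zero_iff hv,
    cross_conjVec_eq_zero_iff (frobVec_ne_zero F K hv), hmk]
  constructor
  · intro h i h1
    exact h (i + 1) (by rw [h1, frob_conj])
  · intro h i h1
    refine h (i - 1) (frob_injective F K ?_)
    rw [h1, frob_conj, sub_add_cancel]

lemma exists_frobVec_eq [IsAlgClosed K] (w : Fin 3 → K) : ∃ v, frobVec F K v = w := by
  choose v hv using fun i => IsAlgClosed.exists_pow_nat_eq (w i) (Fintype.card_pos (α := F))
  exact ⟨v, funext hv⟩

lemma map_frobenius_eq (G : MvPolynomial (Fin 3) K) (v : Fin 3 → K) :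
    eval (frobVec F K v) (map (FiniteField.frobeniusAlgHom F K : K →ₐ[F] K).toRingHom G) =
      eval v G ^ Fintype.card F := by
  rw [eval_map]
  exact (eval₂_comp (FiniteField.frobeniusAlgHom F K : K →ₐ[F] K).toRingHom v G).symm

/-- The global sections of `L_d` are the forms of degree `d` over `F` through the closed point. -/
lemma exists_form_of_mem_globalSections [IsAlgClosed K] {d : ℕ} {s : P.Coords → K}
    (hs : s ∈ globalSections P d) {v : Fin 3 → K} {hv : v ≠ 0}
    (hPv : P.pt = Projectivization.mk K v hv) : ∃ G ∈ formsThrough F v d,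
      ∀ w : P.Coords, Off P.conjVec w.vec → s w = aeval w.vec G := by
  have : Infinite K := IsAlgClosed.instInfinite
  obtain ⟨hreg, hE, hfrob⟩ := hs
  obtain ⟨G, hG, hsG⟩ := exists_form_of_isRegularSection hreg
  -- Frobenius on the coefficients of `G` gives a form that agrees with `G` at every Frobenius image
  -- off the centres. As Frobenius is surjective on `K ^ 3`, the two forms are equal.
  have hH : map (FiniteField.frobeniusAlgHom F K : K →ₐ[F] K).toRingHom G - G = 0 := by
    refine eq_zero_of_eval_off (c := P.conjVec) conjVec_ne_zero fun w hw => ?_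
    obtain ⟨u, rfl⟩ := exists_frobVec_eq (F := F) w
    have hu := frobVec_off_iff.1 hw
    have h1 := hfrob (offCoords hu)
    rw [hsG (offCoords hu) hu, hsG (offCoords hu).frob hw] at h1
    rw [map_sub, map_frobenius_eq, sub_eq_zero]
    exact h1.symm
  have hcoeff : ∀ e, G.coeff e ∈ Set.range (algebraMap F K) := fun e => by
    apply mem_range_of_pow_card_eq
    have := congrArg (coeff e) (sub_eq_zero.1 hH)
    rwa [coeff_map] at this
  obtain ⟨G₀, rfl⟩ : G ∈ Set.range (map (algebraMap F K)) := by
    rw [mem_range_map_iff_coeffs_subset]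
    intro c hc
    obtain ⟨e, -, rfl⟩ := mem_coeffs_iff.1 hc
    exact hcoeff e
  have heval : ∀ w : Fin 3 → K, eval w (map (algebraMap F K) G₀) = aeval w G₀ := fun w => by
    rw [eval_map, aeval_def]
  refine ⟨G₀, ⟨IsHomogeneous.of_map (algebraMap F K).injective hG, ?_⟩, fun w hw => ?_⟩
  · change aeval v G₀ = 0
    have h0 := eval_conjVec_eq_zero hreg hE hsG 0
    have hP : Projectivization.mk K v hv = Projectivization.mk K _ (P.conjVec_ne_zero 0) := by
      rw [mk_conjVec, ← hPv]
      rfl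
    rw [Projectivization.mk_eq_mk_iff'] at hP
    obtain ⟨a, ha⟩ := hP
    rw [← heval, ← ha, eval_smul_of_isHomogeneous hG, h0, mul_zero]
  · rw [← heval, hsG w hw]

/-- A form over `F` through the closed point gives a global section. -/
lemma mem_globalSections_of_form {d : ℕ} {v : Fin 3 → K} {hv : v ≠ 0}
    (hPv : P.pt = Projectivization.mk K v hv) {G : MvPolynomial (Fin 3) F}
    (hG : G ∈ formsThrough F v d) : (fun w : P.Coords => aeval w.vec G) ∈ globalSections P d := by
  obtain ⟨hG, hGv⟩ := hG
  have hGv : aeval v G = 0 := hGv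
  have heval : ∀ w : Fin 3 → K, eval w (map (algebraMap F K) G) = aeval w G := fun w => by
    rw [eval_map, aeval_def]
  refine ⟨fun w₀ => ⟨rename Sum.inl (map (algebraMap F K) G), 1, 0, 0, ?_,
    isWeightedHomogeneous_one _ _, by simp [Coords.eval], fun w _ => ?_⟩, ?_, fun w => ?_⟩
  · intro e he
    obtain ⟨e', rfl, he'⟩ := coeff_rename_ne_zero _ _ _ he
    have hdeg : e'.degree = d := by
      by_contra h
      exact he' ((hG.map (algebraMap F K)).coeff_eq_zero h)
    rw [Finsupp.weight_apply, Finsupp.sum_mapDomain_index (by simp) (by simp [add_smul]),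
      Finsupp.sum_fintype _ _ (by simp)]
    rw [Finsupp.degree_eq_sum] at hdeg
    ext <;> simp [multidegree, Prod.fst_sum, Prod.snd_sum, hdeg]
  · rw [Coords.eval, Coords.eval, map_one, div_one, eval_rename]
    exact (heval _).symm
  -- The form has coefficients in `F`, so its value at the i-th conjugate of `v` is the q^i-th power
  -- of its value at `v`, which is zero.
  · rintro w ⟨i, hi⟩
    have h1 : Projectivization.mk K w.vec w.vec_ne =
        Projectivization.mk K _ (iterate_frobVec_ne_zero (F := F) hv i) := by
      rw [← iterate_frob_mk hv, ← hPv]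
      exact hi
    rw [Projectivization.mk_eq_mk_iff'] at h1
    obtain ⟨a, ha⟩ := h1
    have h2 : (frobVec F K)^[i] v = fun j => v j ^ Fintype.card F ^ (i : ℕ) :=
      funext fun j => iterate_frobVec _ _ _
    change aeval w.vec G = 0
    rw [← heval, ← ha, eval_smul_of_isHomogeneous (hG.map _), heval, h2, ← aeval_pow_card, hGv,
      zero_pow (pow_ne_zero _ Fintype.card_ne_zero), mul_zero]
  · have := aeval_pow_card G w.vec 1
    simp only [pow_one] at this
    rw [this]
    rfl

lemma off_of_ratPoint (z : P.RatPoint) {w : P.Coords} (hw : w.toZ = z.1) :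
    Off P.conjVec w.vec := by
  intro i h
  rw [cross_conjVec_eq_zero_iff w.vec_ne] at h
  refine z.notMem_exceptional ⟨i, ?_⟩
  rw [← hw]
  exact h

/-! ### The code and its parameters -/

namespace FibreCoords

variable (e : FibreCoords P)

lemma exists_rational_vec (z : P.RatPoint) :
    ∃ u : Fin 3 → F, (e.coords z).vec = fun i => algebraMap F K (u i) := by
  have h : ∀ i, (e.coords z).vec i ∈ Set.range (algebraMap F K) := fun i =>
    mem_range_of_pow_card_eq (congrFun (e.rational z) i)
  choose u hu using h
  exact ⟨u, funext fun i => (hu i).symm⟩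

/-- The rational vector which represents the image of a rational point in the plane. -/
noncomputable def ratVec (z : P.RatPoint) : Fin 3 → F := (e.exists_rational_vec z).choose

lemma vec_eq (z : P.RatPoint) : (e.coords z).vec = fun i => algebraMap F K (e.ratVec z i) :=
  (e.exists_rational_vec z).choose_spec

lemma ratVec_ne_zero (z : P.RatPoint) : e.ratVec z ≠ 0 := by
  intro h
  apply (e.coords z).vec_ne
  rw [e.vec_eq, h]
  ext i
  simp

/-- The rational point of the plane below a rational point of `Z`. -/
noncomputable def toPlane (z : P.RatPoint) : ℙ F (Fin 3 → F) :=
  Projectivization.mk F _ (e.ratVec_ne_zero z)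

/-- Away from the centres each line is the join of the point with a centre, so the image in the
plane determines the point of `Z`. -/
lemma toPlane_injective : Function.Injective e.toPlane := by
  intro z z' h
  rw [toPlane, toPlane, Projectivization.mk_eq_mk_iff'] at h
  obtain ⟨a, ha⟩ := h
  have hv : (e.coords z).vec = algebraMap F K a • (e.coords z').vec := by
    rw [e.vec_eq, e.vec_eq, ← ha]
    ext i
    simp
  have hoff := off_of_ratPoint z (e.toZ_coords z)
  have hoff' := off_of_ratPoint z' (e.toZ_coords z')
  apply Subtype.ext
  rw [← e.toZ_coords z, ← e.toZ_coords z', toZ_offCoords _ hoff, toZ_offCoords _ hoff']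
  simp only [Coords.toZ, offCoords, Z.mk.injEq]
  refine ⟨?_, ?_⟩
  · rw [Projectivization.mk_eq_mk_iff']
    exact ⟨_, hv.symm⟩
  · ext1 i
    rw [Projectivization.mk_eq_mk_iff']
    exact ⟨algebraMap F K a, by rw [hv, map_smul, LinearMap.smul_apply]⟩

lemma toPlane_surjective : Function.Surjective e.toPlane := by
  intro x
  induction x with | h u hu =>
  set w : Fin 3 → K := fun i => algebraMap F K (u i) with hw
  have hw0 : w ≠ 0 := algebraMap_vec_ne_zero hu
  have hfix : frobVec F K w = w := frobVec_algebraMap u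
  have hmk : frob F K (Projectivization.mk K w hw0) = Projectivization.mk K w hw0 := by
    rw [frob, Projectivization.map_mk]
    simp only [hfix]
  -- Frobenius moves every centre to a different one, so a rational point is not a centre. Its only
  -- lift to `Z` is then fixed by Frobenius.
  have hoff : Off P.conjVec w := by
    intro i hi
    rw [cross_conjVec_eq_zero_iff hw0] at hi
    rw [hi, frob_conj] at hmk
    refine P.conj_ne ?_ hmk
    fin_cases i <;> decide
  have hrat : (offCoords hoff).toZ.frob = (offCoords hoff).toZ := by
    rw [← Coords.toZ_frob]
    have hoff' : Off P.conjVec (offCoords hoff).frob.vec := frobVec_off_iff.2 hoff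
    rw [toZ_offCoords _ hoff']
    have : (offCoords hoff).frob.vec = w := hfix
    simp only [this]
  obtain ⟨z, hz⟩ : ∃ z : P.RatPoint, z.1 = (offCoords hoff).toZ := ⟨⟨_, hrat⟩, rfl⟩
  refine ⟨z, ?_⟩
  have hπ : Projectivization.mk K (e.coords z).vec (e.coords z).vec_ne =
      Projectivization.mk K w hw0 := congrArg Z.π ((e.toZ_coords z).trans hz)
  rw [Projectivization.mk_eq_mk_iff_crossProduct_eq_zero, e.vec_eq, hw, cross_map] at hπ
  rw [toPlane, Projectivization.mk_eq_mk_iff_crossProduct_eq_zero]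
  ext i
  exact (map_eq_zero _).1 (congrFun hπ i)

/-- The rational points of `Z` are those of the plane. -/
noncomputable def planeEquiv : P.RatPoint ≃ ℙ F (Fin 3 → F) :=
  Equiv.ofBijective e.toPlane ⟨e.toPlane_injective, e.toPlane_surjective⟩

/-- Evaluation of forms at the rational points. -/
noncomputable def evalForms (v : Fin 3 → K) (d : ℕ) : formsThrough F v d →ₗ[F] (P.RatPoint → F) :=
  LinearMap.pi fun z => (aeval (e.ratVec z) : _ →ₐ[F] F).toLinearMap.domRestrict _

lemma evalForms_apply {v : Fin 3 → K} {d : ℕ} (G : formsThrough F v d) (z : P.RatPoint) :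
    e.evalForms v d G z = eval (e.ratVec z) G.1 := rfl

lemma aeval_vec (G : MvPolynomial (Fin 3) F) (z : P.RatPoint) :
    aeval (e.coords z).vec G = algebraMap F K (eval (e.ratVec z) G) := by
  rw [vec_eq]
  exact aeval_algebraMap_apply K (e.ratVec z) G

lemma code_eq_range [IsAlgClosed K] {d : ℕ} {v : Fin 3 → K} {hv : v ≠ 0}
    (hPv : P.pt = Projectivization.mk K v hv) : e.code d = LinearMap.range (e.evalForms v d) := by
  apply le_antisymm
  · rintro _ ⟨s, rfl⟩
    obtain ⟨G, hG, hs⟩ := exists_form_of_mem_globalSections s.2 hPv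
    refine ⟨⟨G, hG⟩, funext fun z => (algebraMap F K).injective ?_⟩
    rw [e.algebraMap_ev, evalForms_apply, hs _ (off_of_ratPoint z (e.toZ_coords z)), aeval_vec]
  · rintro _ ⟨G, rfl⟩
    refine ⟨⟨_, mem_globalSections_of_form hPv G.2⟩, funext fun z => (algebraMap F K).injective ?_⟩
    rw [e.algebraMap_ev, evalForms_apply]
    exact e.aeval_vec G.1 z

lemma natCard_ratPoint (P : CubicPoint F K) :
    Nat.card P.RatPoint = Fintype.card F ^ 2 + Fintype.card F + 1 := by
  rw [Nat.card_congr (Classical.arbitrary (FibreCoords P)).planeEquiv, natCard_plane,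
    Nat.card_eq_fintype_card]

/-- The weight of the codeword of a form. -/
lemma ncard_support_add {v : Fin 3 → K} {d : ℕ} (G : formsThrough F v d) :
    {z | e.evalForms v d G z ≠ 0}.ncard + (zeros G.1).card =
      Fintype.card F ^ 2 + Fintype.card F + 1 := by
  have : Finite P.RatPoint := Finite.of_equiv _ e.planeEquiv.symm
  have h1 : {z | e.evalForms v d G z ≠ 0} = (e.planeEquiv ⁻¹' (zeros G.1 : Set _))ᶜ := by
    ext z
    rw [Set.mem_compl_iff, Set.mem_preimage, SetLike.mem_coe]
    exact (not_congr (mk_mem_zeros G.2.1 (e.ratVec_ne_zero z))).symm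
  have h2 : (e.planeEquiv ⁻¹' (zeros G.1 : Set _)).ncard = (zeros G.1).card := by
    rw [Set.ncard_preimage_of_injective_subset_range e.planeEquiv.injective (by simp),
      Set.ncard_coe_finset]
  rw [h1, ← h2, add_comm, Set.ncard_add_ncard_compl, natCard_ratPoint]

theorem hasParameters [IsAlgClosed K] (hF : 4 ≤ Fintype.card F) :
    HasParameters (e.code 4) (Fintype.card F ^ 2 + Fintype.card F + 1) 12
      (Fintype.card F ^ 2 - 2 * Fintype.card F - 1) := by
  obtain ⟨v, hv, hPv, hv0, hoff, hv3⟩ := P.exists_vec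
  rw [e.code_eq_range hPv]
  have hq := Nat.card_eq_fintype_card (α := F)
  -- The truncated subtractions are genuine because 2q + 1 ≤ q².
  have hdeq : Fintype.card F ^ 2 - 2 * Fintype.card F - 1 + (3 * Fintype.card F + 2) =
      Fintype.card F ^ 2 + Fintype.card F + 1 := by
    have : 2 * Fintype.card F + 1 ≤ Fintype.card F ^ 2 := by nlinarith
    omega
  have hwt : ∀ G : formsThrough F v 4, G ≠ 0 → Fintype.card F ^ 2 - 2 * Fintype.card F - 1 ≤
      {z | e.evalForms v 4 G z ≠ 0}.ncard := fun G hG => by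
    have h1 := e.ncard_support_add G
    have h2 := card_zeros_quartic_le hoff G.2.1 (by simpa using hG) G.2.2
    rw [hq] at h2
    omega
  -- The minimum weight is positive, so no nonzero quartic gives the zero word and the dimension of
  -- the code is that of the space of forms.
  have hinj : Function.Injective (e.evalForms v 4) := by
    rw [← LinearMap.ker_eq_bot, LinearMap.ker_eq_bot']
    intro G hG
    by_contra hne
    have h1 := hwt G hne
    rw [hG] at h1
    have : 2 * Fintype.card F + 2 ≤ Fintype.card F ^ 2 := by nlinarith
    simp at h1
    omega
  refine ⟨natCard_ratPoint P, ?_, ?_, ?_⟩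
  · rw [LinearMap.finrank_range_of_inj hinj]
    have h : Module.finrank F (formsThrough F v 4) + 3 = 15 := finrank_formsThrough hoff hv3 hv0 3
    omega
  · obtain ⟨x, y, hxy⟩ : ∃ x y : ℙ F (Fin 3 → F), x ≠ y := by
      have : Nontrivial (ℙ F (Fin 3 → F)) := by
        rw [← Finite.one_lt_card_iff_nontrivial, natCard_plane]
        nlinarith
      exact exists_pair_ne _
    obtain ⟨Q, hQ, hQ0, hQv, hQx, hQy⟩ := exists_conic hoff hv3 hv0 x.rep y.rep
    obtain ⟨G, hG, hGv, hG0, hcard⟩ := exists_card_zeros_quartic hoff hQ hQ0 hQv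
      (mem_zeros.2 hQx) (mem_zeros.2 hQy) hxy (by omega)
    let G' : formsThrough F v 4 := ⟨G, hG, hGv⟩
    refine ⟨e.evalForms v 4 G', ⟨G', rfl⟩, 0, Submodule.zero_mem _, ?_, ?_⟩
    · intro h
      have := hinj (h.trans (map_zero _).symm)
      exact hG0 (congrArg Subtype.val this)
    · have h1 := e.ncard_support_add G'
      rw [hcard, hq] at h1
      change {z | e.evalForms v 4 G' z ≠ 0}.ncard = _
      omega
  · rintro m ⟨_, ⟨G, rfl⟩, _, ⟨G', rfl⟩, hne, rfl⟩
    have h1 := hwt (G - G') (fun h => hne (by rw [sub_eq_zero.1 h]))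
    refine h1.trans (le_of_eq ?_)
    congr 1
    ext z
    simp only [map_sub, Pi.sub_apply, ne_eq, sub_eq_zero, Set.mem_ofPred_eq]

end FibreCoords

end CubicPoint

end BlowUpCode

/-! ### Existence of cubic points on no rational line -/

namespace BlowUpCode

open Matrix

variable (F K : Type*) [Field F] [Fintype F] [Field K] [Algebra F K]

/-- An algebraically closed field contains an element of degree three over a finite field. -/
lemma exists_pow_card_pow_three_eq [IsAlgClosed K] :
    ∃ α : K, α ^ Fintype.card F ^ 3 = α ∧ α ^ Fintype.card F ≠ α := by
  classical
  have hq : 1 < Fintype.card F := Fintype.one_lt_card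
  have hq3 : 1 < Fintype.card F ^ 3 := Nat.one_lt_pow (by omega) hq
  have hcard : (Fintype.card F : K) = 0 := by
    rw [← map_natCast (algebraMap F K), FiniteField.cast_card_eq_zero, map_zero]
  set f : Polynomial K := Polynomial.X ^ Fintype.card F ^ 3 - Polynomial.X
  have hsep : f.Separable := by
    rw [Polynomial.separable_def']
    refine ⟨0, -1, ?_⟩
    simp [f, Polynomial.derivative_X_pow, hcard]
  have hf0 : f ≠ 0 := FiniteField.X_pow_card_sub_X_ne_zero K hq3
  have hfd : f.natDegree = Fintype.card F ^ 3 := FiniteField.X_pow_card_sub_X_natDegree_eq K hq3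
  set g : Polynomial K := Polynomial.X ^ Fintype.card F - Polynomial.X
  have hg0 : g ≠ 0 := FiniteField.X_pow_card_sub_X_ne_zero K hq
  have hgd : g.natDegree = Fintype.card F := FiniteField.X_pow_card_sub_X_natDegree_eq K hq
  have hroots : f.roots.toFinset.card = Fintype.card F ^ 3 := by
    rw [Multiset.toFinset_card_of_nodup (Polynomial.nodup_roots hsep),
      ← (IsAlgClosed.splits f).natDegree_eq_card_roots, hfd]
  -- Separability gives q³ distinct roots of X^(q³) - X, while at most q elements satisfy x^q = x.
  have hlt : g.roots.toFinset.card < f.roots.toFinset.card := by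
    rw [hroots]
    refine ((Multiset.toFinset_card_le _).trans (Polynomial.card_roots' _)).trans_lt ?_
    rw [hgd]
    nlinarith [sq_nonneg (Fintype.card F)]
  obtain ⟨α, hα, hα'⟩ := Finset.exists_mem_notMem_of_card_lt_card hlt
  rw [Multiset.mem_toFinset, Polynomial.mem_roots hf0] at hα
  rw [Multiset.mem_toFinset, Polynomial.mem_roots hg0] at hα'
  simp only [f, g, Polynomial.IsRoot.def, Polynomial.eval_sub, Polynomial.eval_pow,
    Polynomial.eval_X, sub_eq_zero] at hα hα'
  exact ⟨α, hα, hα'⟩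

/-- Closed points of degree three which lie on no rational line exist. -/
lemma nonempty_cubicPoint [IsAlgClosed K] : Nonempty (CubicPoint F K) := by
  classical
  obtain ⟨α, h3, h1⟩ := exists_pow_card_pow_three_eq F K
  have hinj : ∀ x y : K, x ^ Fintype.card F = y ^ Fintype.card F → x = y := fun x y h =>
    (FiniteField.frobeniusAlgHom F K).toRingHom.injective h
  -- A rational line through (1 : α : α²) would be a nonzero polynomial of degree at most 2 over `F`
  -- vanishing at the three distinct conjugates of α.
  let v : Fin 3 → K := ![1, α, α ^ 2]
  have hv : v ≠ 0 := fun h => one_ne_zero (congrFun h 0)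
  have h12 : α ^ Fintype.card F ^ 2 ≠ α ^ Fintype.card F := by
    intro h
    rw [pow_two, pow_mul] at h
    exact h1 (hinj _ _ h)
  have h02 : α ^ Fintype.card F ^ 2 ≠ α := by
    intro h
    apply h1
    rw [← h, ← pow_mul, ← pow_succ, h3, h]
  have hoff : ∀ w : Fin 3 → K, (∀ i, w i ^ Fintype.card F = w i) → w ≠ 0 → v ⬝ᵥ w ≠ 0 := by
    intro w hw hw0 h0
    let f : Polynomial K := Polynomial.C (w 2) * Polynomial.X ^ 2 +
      Polynomial.C (w 1) * Polynomial.X + Polynomial.C (w 0)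
    have hroot : ∀ x, x ∈ ({α, α ^ Fintype.card F, α ^ Fintype.card F ^ 2} : Finset K) →
        f.eval x = 0 := by
      have hstep : ∀ x, f.eval x = 0 → f.eval (x ^ Fintype.card F) = 0 := by
        intro x hx
        have := congrArg (FiniteField.frobeniusAlgHom F K) hx
        simp only [f, Polynomial.eval_add, Polynomial.eval_mul, Polynomial.eval_C,
          Polynomial.eval_pow, Polynomial.eval_X, map_add, map_mul, map_pow, map_zero] at this ⊢
        simpa only [FiniteField.coe_frobeniusAlgHom, hw] using this
      have hα : f.eval α = 0 := by
        rw [vec3_dotProduct] at h0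
        simp only [v, cons_val_zero, cons_val_one, cons_val] at h0
        simp only [f, Polynomial.eval_add, Polynomial.eval_mul, Polynomial.eval_C,
          Polynomial.eval_pow, Polynomial.eval_X]
        linear_combination h0
      intro x hx
      simp only [Finset.mem_insert, Finset.mem_singleton] at hx
      rcases hx with rfl | rfl | rfl
      · exact hα
      · exact hstep _ hα
      · rw [pow_two, pow_mul]
        exact hstep _ (hstep _ hα)
    have hf : f = 0 := by
      refine Polynomial.eq_zero_of_natDegree_lt_card_of_eval_eq_zero' f _ hroot ?_
      rw [Finset.card_eq_three.2 ⟨_, _, _, h1.symm, h02.symm, h12.symm, rfl⟩]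
      exact Nat.lt_succ_of_le Polynomial.natDegree_quadratic_le
    apply hw0
    have hc0 := congrArg (Polynomial.coeff · 0) hf
    have hc1 := congrArg (Polynomial.coeff · 1) hf
    have hc2 := congrArg (Polynomial.coeff · 2) hf
    simp [f, Polynomial.coeff_X, Polynomial.coeff_C] at hc0 hc1 hc2
    ext i
    fin_cases i <;> assumption
  refine ⟨⟨Projectivization.mk K v hv, ?_, ?_⟩⟩
  · have : Fact (Nat.Prime 3) := ⟨Nat.prime_three⟩
    refine Function.minimalPeriod_eq_prime (p := 3) ?_ ?_
    · rw [Function.IsPeriodicPt, Function.IsFixedPt, CubicPoint.iterate_frob_mk]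
      congr 1
      ext i
      rw [CubicPoint.iterate_frobVec]
      fin_cases i
      · simp [v]
      · simpa [v] using h3
      · simp only [v, Fin.reduceFinMk, cons_val]
        rw [← pow_mul, mul_comm, pow_mul, h3]
    · rw [Function.IsFixedPt, frob, Projectivization.map_mk, Projectivization.mk_eq_mk_iff']
      rintro ⟨a, ha⟩
      have ha0 := congrFun ha 0
      have ha1 := congrFun ha 1
      rw [CubicPoint.frobVec_apply_eq, Pi.smul_apply] at ha0 ha1
      simp only [v, cons_val_zero, cons_val_one, smul_eq_mul, mul_one, one_pow] at ha0 ha1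
      rw [ha0, one_mul] at ha1
      exact h1 ha1.symm
  · intro l hl
    induction l using Projectivization.ind with | h w hw =>
    obtain ⟨k, hk⟩ := Function.ne_iff.1 hw
    have hk : w k ≠ 0 := hk
    rw [frob, Projectivization.map_mk, Projectivization.mk_eq_mk_iff'] at hl
    obtain ⟨a, ha⟩ := hl
    rw [Projectivization.orthogonal_mk]
    intro h0
    -- Frobenius fixes the line only up to a scalar; making its k-th coefficient 1 makes every
    -- coefficient fixed.
    refine hoff ((w k)⁻¹ • w) (fun i => ?_) (smul_ne_zero (inv_ne_zero hk) hw) ?_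
    · have hai := congrFun ha i
      have hak := congrFun ha k
      rw [CubicPoint.frobVec_apply_eq, Pi.smul_apply, smul_eq_mul] at hai hak
      have ha0 : a ≠ 0 := by
        rintro rfl
        rw [zero_mul] at hak
        exact pow_ne_zero _ hk hak.symm
      rw [Pi.smul_apply, smul_eq_mul, mul_pow, inv_pow, ← hai, ← hak]
      field_simp
    · rw [dotProduct_smul, h0, smul_zero]

end BlowUpCode

theorem mainTheorem9 {F K : Type*} [Field F] [Fintype F] [Field K] [Algebra F K]
    [IsAlgClosure F K] :
    (4 ≤ Fintype.card F →
      ∀ (P : BlowUpCode.CubicPoint F K) (e : BlowUpCode.CubicPoint.FibreCoords P),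
        BlowUpCode.HasParameters (e.code 4)
          (Fintype.card F ^ 2 + Fintype.card F + 1) 12
          (Fintype.card F ^ 2 - 2 * Fintype.card F - 1)) ∧
    (Fintype.card F = 7 →
      ∃ (P : BlowUpCode.CubicPoint F K) (e : BlowUpCode.CubicPoint.FibreCoords P),
        BlowUpCode.HasParameters (e.code 4) 57 12 34) := by
  have : IsAlgClosed K := IsAlgClosure.isAlgClosed F
  refine ⟨fun hF P e => e.hasParameters hF, fun hF => ?_⟩
  obtain ⟨P⟩ := BlowUpCode.nonempty_cubicPoint F K
  obtain ⟨e⟩ := (inferInstance : Nonempty (BlowUpCode.CubicPoint.FibreCoords P))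
  have h := e.hasParameters (by omega)
  rw [hF] at h
  exact ⟨P, e, h⟩
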